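/- Let $t\in\mathbb{C}$ with $0<|t|<1$, let $\mathbb{S}^3\subset\mathbb{C}^2$ be the unit sphere with surface measure, and put $$\mathcal{L}=\bar z_1\frac{\partial}{\partial z_2}-\bar z_2\frac{\partial}{\partial z_1},\quad \bar{\mathcal{L}}=z_1\frac{\partial}{\partial \bar z_2}-z_2\frac{\partial}{\partial \bar z_1},\quad \mathcal{L}_t=\mathcal{L}+\bar t\,\bar{\mathcal{L}},\quad \bar{\mathcal{L}}_t=\bar{\mathcal{L}}+t\,\mathcal{L},\quad h=\frac{1+|t|^2}{(1-|t|^2)^2}.$$ Let $\square_b^t=-\mathcal{L}_t\,h\,\bar{\mathcal{L}}_t$ on $C^\infty(\mathbb{S}^3)$, and denote its closure in $L^2(\mathbb{S}^3)$ by the same symbol. For an unbounded operator the essential spectrum is the set of those points of the spectrum that are accumulation points of the spectrum or have an infinite dimensional eigenspace. Then: 1. $\square_b^t$ is self-adjoint in $L^2(\mathbb{S}^3)$. 2. $0$ is in the essential spectrum of $\square_b^t$; moreover $0$ is an accumulation point of the spectrum of $\square_b^t$. 3. Let $k\ge 1$, and let $f\neq 0$ be the restriction to $\mathbb{S}^3$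 of a harmonic polynomial that is homogeneous of degree $0$ in $z$ and of degree $2k-1$ in $\bar z$. Then $W=\operatorname{span}\{\bar{\mathcal{L}}f,\bar{\mathcal{L}}^3f,\dots,\bar{\mathcal{L}}^{2k-1}f\}$ consists of restrictions to $\mathbb{S}^3$ of homogeneous harmonic polynomials of degree $2k-1$, it is invariant under $\square_b^t$, and the smallest (real) eigenvalue $\lambda_{\min}$ of $\square_b^t$ on $W$ exists and satisfies $$0<\lambda_{\min}\le h\,(2k-1)\sqrt{k}\,|t|^{2k}.$$ 4. The Rossi sphere $(\mathbb{S}^3,\mathcal{L}_t)$ is not globally CR-embeddable: for no $N$ is there a smooth embedding $\mathbb{S}^3\to\mathbb{C}^N$ whose components are all annihilated by $\bar{\mathcal{L}}_t$. -/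

import Mathlib

open scoped Manifold ContDiff Topology ComplexConjugate
open MeasureTheory

noncomputable section

namespace Rossi

/-- The space `ℂ²` with its Hermitian norm. -/
abbrev C2 := EuclideanSpace ℂ (Fin 2)

instance finrankC2 : Fact (Module.finrank ℝ C2 = 3 + 1) := ⟨by
  rw [← Module.finrank_mul_finrank ℝ ℂ C2]; simp⟩

/-- The unit sphere `𝕊³ ⊂ ℂ²` (with Mathlib's smooth structure). -/
abbrev S3 := Metric.sphere (0 : C2) 1

/-- The surface area measure on `𝕊³`. -/
abbrev sigma : Measure S3 := Measure.toSphere (volume : Measure C2)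

/-- The Hilbert space `L²(𝕊³)`. -/
abbrev L2S3 := Lp ℂ 2 sigma

/-- The complex vector space `C^∞(𝕊³)` of smooth complex valued functions on the sphere. -/
def Smooth : Submodule ℂ (S3 → ℂ) where
  carrier := {f | ContMDiff (𝓡 3) 𝓘(ℝ, ℂ) ∞ f}
  add_mem' hf hg := ContMDiff.add hf hg
  zero_mem' := contMDiff_const
  smul_mem' c _ hf := by
    have h : ContMDiff 𝓘(ℝ, ℂ) 𝓘(ℝ, ℂ) ∞ (fun w : ℂ => c * w) :=
      (contDiff_const.mul contDiff_id).contMDiff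
    exact h.comp hf

/-- The extension of a function on `𝕊³` to `ℂ² \ {0}` that is constant on rays from the origin.
The complex vector fields below are tangent to the sphere, so that any other smooth extension
gives the same derivative on the sphere. -/
def ext (f : S3 → ℂ) (z : C2) : ℂ :=
  if h : z = 0 then 0 else f ⟨(‖z‖⁻¹ : ℝ) • z, by simp [norm_smul, h]⟩

/-- The Wirtinger derivative `∂F/∂z_j`. -/
def dz (j : Fin 2) (F : C2 → ℂ) (z : C2) : ℂ :=
  (1 / 2 : ℂ) * (fderiv ℝ F z (EuclideanSpace.single j 1)
    - Complex.I * fderiv ℝ F z (EuclideanSpace.single j Complex.I))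

/-- The Wirtinger derivative `∂F/∂z̄_j`. -/
def dzbar (j : Fin 2) (F : C2 → ℂ) (z : C2) : ℂ :=
  (1 / 2 : ℂ) * (fderiv ℝ F z (EuclideanSpace.single j 1)
    + Complex.I * fderiv ℝ F z (EuclideanSpace.single j Complex.I))

theorem ext_coe (f : S3 → ℂ) (z : S3) : ext f z = f z := by
  have hz : ‖(z : C2)‖ = 1 := by simp
  have h0 : (z : C2) ≠ 0 := by
    intro h
    simp [h] at hz
  simp only [ext, h0, dite_false]
  congr 1
  ext1
  simp [hz]

theorem ext_contDiffOn {f : S3 → ℂ} (hf : f ∈ Smooth) :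
    ContDiffOn ℝ ∞ (ext f) {0}ᶜ := by
  let U : TopologicalSpace.Opens C2 := ⟨{0}ᶜ, isOpen_compl_singleton⟩
  have hU : ∀ x : U, (x : C2) ≠ 0 := fun x => x.2
  have hc : ContMDiff 𝓘(ℝ, C2) 𝓘(ℝ, C2) ∞ (fun x : U => (‖(x : C2)‖⁻¹ : ℝ) • (x : C2)) := by
    intro x
    refine (contMDiffAt_subtype_iff (U := U)
      (f := fun y : C2 => (‖y‖⁻¹ : ℝ) • y) (x := x)).2 ?_
    refine ContDiffAt.contMDiffAt ?_
    exact ((contDiffAt_norm ℝ (hU x)).inv (norm_ne_zero_iff.2 (hU x))).smul contDiffAt_id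
  have hs := ContMDiff.codRestrict_sphere (n := 3) hc (fun x => by simp [norm_smul, hU x])
  have hcomp : ContMDiff 𝓘(ℝ, C2) 𝓘(ℝ, ℂ) ∞ (fun x : U => ext f x) := by
    refine (ContMDiff.comp (show ContMDiff (𝓡 3) 𝓘(ℝ, ℂ) ∞ f from hf) hs).congr ?_
    intro x
    simp only [ext, hU x, dite_false, Function.comp]
    rfl
  intro x hx
  refine ContDiffAt.contDiffWithinAt ?_
  exact ((contMDiffAt_subtype_iff (U := U) (x := ⟨x, hx⟩)).1 (hcomp ⟨x, hx⟩)).contDiffAt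

theorem ext_differentiableAt {f : S3 → ℂ} (hf : f ∈ Smooth) (z : S3) :
    DifferentiableAt ℝ (ext f) (z : C2) := by
  have h0 : (z : C2) ≠ 0 := by
    intro h
    have hz : ‖(z : C2)‖ = 1 := by simp
    simp [h] at hz
  exact ((ext_contDiffOn hf).contDiffAt (isOpen_compl_singleton.mem_nhds h0)).differentiableAt
    (by simp)

theorem restrict_smooth {F : C2 → ℂ} (hF : ContDiffOn ℝ ∞ F {0}ᶜ) :
    (fun z : S3 => F z) ∈ Smooth := by
  refine (hF.contMDiffOn).comp_contMDiff (contMDiff_coe_sphere (n := 3)) ?_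
  intro z h
  have hz : ‖(z : C2)‖ = 1 := by simp
  rw [Set.mem_singleton_iff.1 h] at hz
  simp at hz

theorem contDiffOn_fderiv_ext {f : S3 → ℂ} (hf : f ∈ Smooth) (v : C2) :
    ContDiffOn ℝ ∞ (fun z => fderiv ℝ (ext f) z v) {0}ᶜ :=
  ((ext_contDiffOn hf).fderiv_of_isOpen isOpen_compl_singleton (by simp)).clm_apply contDiffOn_const

theorem contDiff_coord (j : Fin 2) : ContDiff ℝ ∞ (fun z : C2 => z j) :=
  ((EuclideanSpace.proj (𝕜 := ℂ) j).restrictScalars ℝ).contDiff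

theorem contDiff_conj_coord (j : Fin 2) : ContDiff ℝ ∞ (fun z : C2 => conj (z j)) :=
  Complex.conjCLE.contDiff.comp (contDiff_coord j)

theorem contDiffOn_dz_ext {f : S3 → ℂ} (hf : f ∈ Smooth) (j : Fin 2) :
    ContDiffOn ℝ ∞ (dz j (ext f)) {0}ᶜ :=
  contDiffOn_const.mul ((contDiffOn_fderiv_ext hf _).sub
    (contDiffOn_const.mul (contDiffOn_fderiv_ext hf _)))

theorem contDiffOn_dzbar_ext {f : S3 → ℂ} (hf : f ∈ Smooth) (j : Fin 2) :
    ContDiffOn ℝ ∞ (dzbar j (ext f)) {0}ᶜ :=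
  contDiffOn_const.mul ((contDiffOn_fderiv_ext hf _).add
    (contDiffOn_const.mul (contDiffOn_fderiv_ext hf _)))

theorem fderiv_ext_add {f g : S3 → ℂ} (hf : f ∈ Smooth) (hg : g ∈ Smooth) (z : S3) :
    fderiv ℝ (ext (f + g)) (z : C2) = fderiv ℝ (ext f) z + fderiv ℝ (ext g) z := by
  rw [← fderiv_add (ext_differentiableAt hf z) (ext_differentiableAt hg z)]
  congr 1
  funext w
  by_cases h : w = 0 <;> simp [ext, h]

theorem fderiv_ext_smul (c : ℂ) {f : S3 → ℂ} (hf : f ∈ Smooth) (z : S3) :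
    fderiv ℝ (ext (c • f)) (z : C2) = c • fderiv ℝ (ext f) z := by
  rw [← fderiv_const_smul (ext_differentiableAt hf z) c]
  congr 1
  funext w
  by_cases h : w = 0 <;> simp [ext, h]

/-- The vector field `𝓛 = z̄₁ ∂/∂z₂ - z̄₂ ∂/∂z₁` acting on `C^∞(𝕊³)`
(`z₁`, `z₂` are the coordinates with index `0`, `1`). -/
def L : Module.End ℂ Smooth where
  toFun f := ⟨fun z => conj ((z : C2) 0) * dz 1 (ext f) z - conj ((z : C2) 1) * dz 0 (ext f) z,
    restrict_smooth (((contDiff_conj_coord 0).contDiffOn.mul (contDiffOn_dz_ext f.2 1)).sub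
      ((contDiff_conj_coord 1).contDiffOn.mul (contDiffOn_dz_ext f.2 0)))⟩
  map_add' f g := by
    ext z
    simp only [dz, Submodule.coe_add, fderiv_ext_add f.2 g.2, _root_.add_apply,
      Pi.add_apply]
    ring
  map_smul' c f := by
    ext z
    simp only [dz, Submodule.coe_smul, fderiv_ext_smul c f.2, _root_.smul_apply,
      Pi.smul_apply, smul_eq_mul, RingHom.id_apply]
    ring

/-- The conjugate vector field `𝓛̄ = z₁ ∂/∂z̄₂ - z₂ ∂/∂z̄₁` acting on `C^∞(𝕊³)`. -/
def Lbar : Module.End ℂ Smooth where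
  toFun f := ⟨fun z => (z : C2) 0 * dzbar 1 (ext f) z - (z : C2) 1 * dzbar 0 (ext f) z,
    restrict_smooth (((contDiff_coord 0).contDiffOn.mul (contDiffOn_dzbar_ext f.2 1)).sub
      ((contDiff_coord 1).contDiffOn.mul (contDiffOn_dzbar_ext f.2 0)))⟩
  map_add' f g := by
    ext z
    simp only [dzbar, Submodule.coe_add, fderiv_ext_add f.2 g.2, _root_.add_apply,
      Pi.add_apply]
    ring
  map_smul' c f := by
    ext z
    simp only [dzbar, Submodule.coe_smul, fderiv_ext_smul c f.2, _root_.smul_apply,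
      Pi.smul_apply, smul_eq_mul, RingHom.id_apply]
    ring

/-- The Rossi vector field `𝓛_t = 𝓛 + t̄ 𝓛̄`, which spans the CR structure of the Rossi sphere. -/
def Lt (t : ℂ) : Module.End ℂ Smooth := L + conj t • Lbar

/-- The conjugate Rossi vector field `𝓛̄_t = 𝓛̄ + t 𝓛`; its kernel consists of the smooth
CR functions. -/
def Ltbar (t : ℂ) : Module.End ℂ Smooth := Lbar + t • L

/-- The normalization constant `h = (1 + |t|²) / (1 - |t|²)²`. -/
def h (t : ℂ) : ℝ := (1 + ‖t‖ ^ 2) / (1 - ‖t‖ ^ 2) ^ 2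

/-- The Kohn Laplacian `□_b^t = -𝓛_t h 𝓛̄_t` on `C^∞(𝕊³)`. -/
def box (t : ℂ) : Module.End ℂ Smooth := -(Lt t * ((h t : ℂ) • Ltbar t))

/-- The inclusion of `C^∞(𝕊³)` into `L²(𝕊³)`. -/
def toL2 : Smooth →ₗ[ℂ] L2S3 :=
  (ContinuousMap.toLp 2 sigma ℂ).toLinearMap ∘ₗ
    { toFun := fun f => (⟨f.1, ContMDiff.continuous f.2⟩ : C(S3, ℂ))
      map_add' := fun _ _ => rfl
      map_smul' := fun _ _ => rfl }

theorem toL2_injective : Function.Injective toL2 := by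
  intro f g hfg
  have := ContinuousMap.toLp_injective sigma hfg
  exact Subtype.ext (congrArg (fun u : C(S3, ℂ) => (u : S3 → ℂ)) this)

/-- The Kohn Laplacian as an unbounded operator in `L²(𝕊³)` with domain `C^∞(𝕊³)`. -/
def boxSmooth (t : ℂ) : L2S3 →ₗ.[ℂ] L2S3 where
  domain := LinearMap.range toL2
  toFun := toL2 ∘ₗ box t ∘ₗ (LinearEquiv.ofInjective toL2 toL2_injective).symm.toLinearMap

/-- The Kohn Laplacian `□_b^t` as a closed unbounded operator in `L²(𝕊³)`: the closure of the
differential operator on smooth functions. -/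
def boxL2 (t : ℂ) : L2S3 →ₗ.[ℂ] L2S3 := (boxSmooth t).closure

section Spectrum

variable {H : Type*} [NormedAddCommGroup H] [InnerProductSpace ℂ H]

/-- `lam` is in the resolvent set of the unbounded operator `A`:
`A - lam` maps the domain of `A` bijectively to `H` with bounded inverse `R`. -/
def InResolventSet (A : H →ₗ.[ℂ] H) (lam : ℂ) : Prop :=
  ∃ R : H →L[ℂ] H,
    (∀ x : A.domain, R (A x - lam • (x : H)) = x) ∧
    (∀ y : H, ∃ x : A.domain, (x : H) = R y ∧ A x - lam • (x : H) = y)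

/-- The spectrum of an unbounded operator. -/
def spec (A : H →ₗ.[ℂ] H) : Set ℂ := {lam | ¬ InResolventSet A lam}

/-- The eigenspace `ker (A - lam)`. -/
def eigenspace (A : H →ₗ.[ℂ] H) (lam : ℂ) : Submodule ℂ A.domain :=
  LinearMap.ker (A.toFun - lam • A.domain.subtype)

/-- The essential spectrum (of a self-adjoint operator): the points of the spectrum that are not
isolated points of the spectrum with finite dimensional eigenspace. -/
def essSpec (A : H →ₗ.[ℂ] H) : Set ℂ :=
  {lam ∈ spec A | AccPt lam (Filter.principal (spec A)) ∨
    ¬ FiniteDimensional ℂ (eigenspace A lam)}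

end Spectrum

/-- Polynomials in `z₁, z₂, z̄₁, z̄₂`: `Sum.inl i` stands for `z_i` and `Sum.inr i` for `z̄_i`. -/
abbrev Poly := MvPolynomial (Fin 2 ⊕ Fin 2) ℂ

/-- The value of a polynomial in `z, z̄` at a point of `ℂ²`. -/
def Poly.value (P : Poly) (z : C2) : ℂ :=
  MvPolynomial.eval (Sum.elim (fun i => z i) (fun i => conj (z i))) P

/-- `Δ P = 4 ∑ ∂²P/∂z_i ∂z̄_i = 0`. -/
def Poly.IsHarmonic (P : Poly) : Prop :=
  4 * ∑ i : Fin 2, MvPolynomial.pderiv (Sum.inl i) (MvPolynomial.pderiv (Sum.inr i) P) = 0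

/-- `P` is homogeneous of bidegree `(p, q)`. -/
def Poly.IsBihomogeneous (P : Poly) (p q : ℕ) : Prop :=
  ∀ m ∈ P.support, m (Sum.inl 0) + m (Sum.inl 1) = p ∧ m (Sum.inr 0) + m (Sum.inr 1) = q

/-- `f ∈ 𝓗_m(𝕊³)`: a spherical harmonic of degree `m`. -/
def IsSphericalHarmonic (m : ℕ) (f : Smooth) : Prop :=
  ∃ P : Poly, P.IsHomogeneous m ∧ Poly.IsHarmonic P ∧ ∀ z : S3, f.1 z = Poly.value P z

/-- `f ∈ 𝓗_{p,q}(𝕊³)`: a spherical harmonic of bidegree `(p, q)`. -/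
def IsBisphericalHarmonic (p q : ℕ) (f : Smooth) : Prop :=
  ∃ P : Poly, Poly.IsBihomogeneous P p q ∧ Poly.IsHarmonic P ∧ ∀ z : S3, f.1 z = Poly.value P z

/-- `W = span {𝓛̄ f, 𝓛̄³ f, …, 𝓛̄^{2k-1} f}`. -/
def W (k : ℕ) (f : Smooth) : Submodule ℂ Smooth :=
  Submodule.span ℂ (Set.range fun j : Fin k => (Lbar ^ (2 * (j : ℕ) + 1)) f)

/-- A global CR embedding of the Rossi sphere `(𝕊³, 𝓛_t)` into `ℂ^N`: a smooth embedding whose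
components are CR functions. -/
def IsCREmbedding (t : ℂ) {N : ℕ} (g : Fin N → Smooth) : Prop :=
  Manifold.IsSmoothEmbedding (𝓡 3) 𝓘(ℝ, EuclideanSpace ℂ (Fin N)) ∞
    (fun z : S3 => (WithLp.toLp 2 fun j => (g j).1 z : EuclideanSpace ℂ (Fin N))) ∧
  ∀ j, Ltbar t (g j) = 0

end Rossi

end

/-!
The functions on `𝕊³` that come from polynomials of degree at most `n` form a finite-dimensional
space invariant under the symmetric operator `□_b^t`, and the union of these spaces is dense. A
symmetric operator with such an exhaustion is essentially self-adjoint, because the orthogonal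
projections onto the spaces commute with it.

Choose `a` with `a² = -t̄`. The linear forms are spanned by eigenvectors of `𝓛_t` with eigenvalues
`± a`, so products of `m` of them diagonalize `𝓛_t` on polynomials of degree `m`; for odd `m` the
eigenvalues are odd multiples of `a`, hence nonzero. Thus odd functions can be approximated by the
range of `𝓛_t`, which is orthogonal to the kernel of `𝓛̄_t`. So every CR function is even, and CR
functions cannot separate antipodal points.

A function `f` of bidegree `(0, 2k-1)` is a lowest weight vector for the `sl₂`-triple containing
`𝓛̄` and `𝓛`. Hence the `𝓛̄^j f` are orthogonal, their norms are explicit, and a suitable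
combination of `𝓛̄ f, 𝓛̄³ f, …, 𝓛̄^{2k-1} f` is mapped by `𝓛̄_t` to a multiple of `f`, all other
terms cancelling in pairs. Its Rayleigh quotient is `O(k |t|^{2k})`, while the eigenvalues are
positive because CR functions are even; so they accumulate at `0`.
-/

noncomputable section

namespace Rossi

section SphereMap

open scoped Pointwise

variable {E : Type*} [NormedAddCommGroup E] [NormedSpace ℝ E]

/-- The action of a linear isometry on the unit sphere. -/
def sphereMap (U : E ≃ₗᵢ[ℝ] E) (z : Metric.sphere (0 : E) 1) : Metric.sphere (0 : E) 1 :=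
  ⟨U z, by simp⟩

@[simp] theorem coe_sphereMap (U : E ≃ₗᵢ[ℝ] E) (z : Metric.sphere (0 : E) 1) :
    (sphereMap U z : E) = U z := rfl

theorem continuous_sphereMap (U : E ≃ₗᵢ[ℝ] E) : Continuous (sphereMap U) :=
  (U.continuous.comp continuous_subtype_val).subtype_mk _

theorem Ioo_smul_image_preimage_sphereMap (U : E ≃ₗᵢ[ℝ] E) (s : Set (Metric.sphere (0 : E) 1)) :
    Set.Ioo (0 : ℝ) 1 • ((↑) '' (sphereMap U ⁻¹' s) : Set E) =
      U ⁻¹' (Set.Ioo (0 : ℝ) 1 • ((↑) '' s : Set E)) := by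
  ext x
  simp only [Set.mem_smul, Set.mem_image, Set.mem_preimage]
  constructor
  · rintro ⟨r, hr, _, ⟨y, hy, rfl⟩, rfl⟩
    exact ⟨r, hr, _, ⟨_, hy, rfl⟩, by simp⟩
  · rintro ⟨r, hr, _, ⟨y, hy, rfl⟩, hx⟩
    have hyU : sphereMap U (sphereMap U.symm y) = y := by ext1; simp
    exact ⟨r, hr, _, ⟨sphereMap U.symm y, hyU.symm ▸ hy, rfl⟩, U.injective (by simpa using hx)⟩

theorem measurePreserving_sphereMap [MeasurableSpace E] [BorelSpace E] {μ : Measure E}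
    (U : E ≃ₗᵢ[ℝ] E) (hU : MeasurePreserving U μ μ) :
    MeasurePreserving (sphereMap U) μ.toSphere μ.toSphere := by
  have hmeas : Measurable (sphereMap U) := (continuous_sphereMap U).measurable
  refine ⟨hmeas, ?_⟩
  ext s hs
  rw [Measure.map_apply hmeas hs, Measure.toSphere_apply' _ (hmeas hs),
    Ioo_smul_image_preimage_sphereMap,
    hU.measure_preimage_emb U.toHomeomorph.measurableEmbedding, Measure.toSphere_apply' _ hs]

end SphereMap

section Rotation

variable {E : Type*} [NormedAddCommGroup E] [InnerProductSpace ℝ E] {J : E →ₗᵢ[ℝ] E}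

theorem inner_self_map_eq_zero (hJ : ∀ x, J (J x) = -x) (x : E) : inner ℝ x (J x) = 0 := by
  have := J.inner_map_map x (J x)
  rw [hJ, inner_neg_right, real_inner_comm] at this
  linarith

theorem norm_cos_smul_add_sin_smul (hJ : ∀ x, J (J x) = -x) (s : ℝ) (x : E) :
    ‖Real.cos s • x + Real.sin s • J x‖ = ‖x‖ := by
  rw [← sq_eq_sq₀ (norm_nonneg _) (norm_nonneg _), norm_add_sq_real, real_inner_smul_left,
    real_inner_smul_right, inner_self_map_eq_zero hJ, norm_smul, norm_smul, J.norm_map,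
    Real.norm_eq_abs, Real.norm_eq_abs, mul_pow, mul_pow, sq_abs, sq_abs]
  linear_combination ‖x‖ ^ 2 * Real.cos_sq_add_sin_sq s

/-- The flow `exp (s J) = cos s + sin s J` of the linear vector field `J`, where `J² = -1`. -/
def rotation (hJ : ∀ x, J (J x) = -x) (s : ℝ) : E ≃ₗᵢ[ℝ] E :=
  LinearIsometryEquiv.ofSurjective
    ⟨Real.cos s • LinearMap.id + Real.sin s • J.toLinearMap, norm_cos_smul_add_sin_smul hJ s⟩
    fun y => ⟨Real.cos s • y - Real.sin s • J y, by
      simp only [LinearMap.add_apply, LinearMap.smul_apply, LinearMap.id_apply,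
        LinearIsometry.coe_toLinearMap, LinearIsometry.coe_mk, map_sub, map_smul, hJ]
      linear_combination (norm := module) congrArg (· • y) (Real.cos_sq_add_sin_sq s)⟩

theorem rotation_apply (hJ : ∀ x, J (J x) = -x) (s : ℝ) (x : E) :
    rotation hJ s x = Real.cos s • x + Real.sin s • J x := rfl

theorem rotation_zero (hJ : ∀ x, J (J x) = -x) (x : E) : rotation hJ 0 x = x := by
  simp [rotation_apply]

theorem hasDerivAt_rotation (hJ : ∀ x, J (J x) = -x) (s : ℝ) (x : E) :
    HasDerivAt (fun s => rotation hJ s x) (J (rotation hJ s x)) s := by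
  simp only [rotation_apply, map_add, map_smul, hJ]
  refine (((Real.hasDerivAt_cos s).smul_const x).add
    ((Real.hasDerivAt_sin s).smul_const (J x))).congr_deriv ?_
  module

end Rotation

theorem integral_deriv_flow_eq_zero {X F : Type*} [TopologicalSpace X] [CompactSpace X]
    [MeasurableSpace X] [OpensMeasurableSpace X] [NormedAddCommGroup F] [NormedSpace ℝ F]
    [SecondCountableTopologyEither X F] {μ : Measure X} [IsFiniteMeasure μ] {φ : ℝ → X → X}
    (hφ : ∀ s, Continuous (φ s)) (hμ : ∀ s, MeasurePreserving (φ s) μ μ) {G G' : X → F}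
    (hG : Continuous G) (hG' : Continuous G')
    (hderiv : ∀ x s, HasDerivAt (fun s => G (φ s x)) (G' (φ s x)) s) : ∫ x, G' x ∂μ = 0 := by
  have integral_comp : ∀ {K : X → F}, Continuous K → ∀ s, ∫ x, K (φ s x) ∂μ = ∫ x, K x ∂μ := by
    intro K hK s
    conv_rhs => rw [← (hμ s).map_eq]
    exact (integral_map (hμ s).measurable.aemeasurable hK.aestronglyMeasurable).symm
  obtain ⟨B, hB⟩ := isCompact_univ.exists_bound_of_continuousOn hG'.continuousOn
  have hasDerivAt_integral := (hasDerivAt_integral_of_dominated_loc_of_deriv_le (μ := μ)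
    (x₀ := (0 : ℝ)) (F := fun s x => G (φ s x)) (F' := fun s x => G' (φ s x))
    (bound := fun _ => B) Filter.univ_mem
    (.of_forall fun s => (hG.comp (hφ s)).aestronglyMeasurable)
    ((hG.comp (hφ 0)).integrable_of_hasCompactSupport (HasCompactSupport.of_compactSpace _))
    (hG'.comp (hφ 0)).aestronglyMeasurable
    (.of_forall fun x s _ => hB _ trivial) (integrable_const B)
    (.of_forall fun x s _ => hderiv x s)).2
  simp only [integral_comp hG, integral_comp hG'] at hasDerivAt_integral
  exact hasDerivAt_integral.unique (hasDerivAt_const _ _)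

section PolynomialDerivations

open MvPolynomial

theorem hasDerivAt_eval {𝕜 A σ : Type*} [NontriviallyNormedField 𝕜] [NormedCommRing A]
    [NormedAlgebra 𝕜 A] [Fintype σ] {x : 𝕜 → σ → A} {x' : σ → A} {s : 𝕜}
    (hx : ∀ i, HasDerivAt (fun s => x s i) (x' i) s) (P : MvPolynomial σ A) :
    HasDerivAt (fun s => eval (x s) P) (∑ i, x' i * eval (x s) (pderiv i P)) s := by
  classical
  induction P using MvPolynomial.induction_on with
  | C a => simpa using hasDerivAt_const s a
  | add P Q hP hQ =>
    simp only [map_add, mul_add, Finset.sum_add_distrib]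
    exact hP.add hQ
  | mul_X P j hP =>
    simp only [eval_mul, eval_X]
    refine (hP.mul (hx j)).congr_deriv ?_
    simp only [Derivation.leibniz, pderiv_X, Pi.single_apply, smul_eq_mul, map_add, eval_mul,
      eval_X, apply_ite (eval (x s)), map_zero, mul_add, Finset.sum_add_distrib,
      mul_ite, mul_one, mul_zero, Finset.sum_ite_eq, Finset.mem_univ, if_true, Finset.sum_mul]
    rw [add_comm, mul_comm (x' j)]
    exact congrArg (_ + ·) (Finset.sum_congr rfl fun i _ => by ring)

variable {σ R : Type*}

theorem pderiv_comm [CommSemiring R] (i j : σ) (P : MvPolynomial σ R) :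
    pderiv i (pderiv j P) = pderiv j (pderiv i P) := by
  classical
  induction P using MvPolynomial.induction_on with
  | C a => simp only [pderiv_C, map_zero]
  | add P Q hP hQ => simp only [map_add, hP, hQ]
  | mul_X P k hP =>
    simp only [Derivation.leibniz, smul_eq_mul, pderiv_X, map_add, Pi.single_apply, hP,
      apply_ite (pderiv _), Derivation.map_one_eq_zero, map_zero, ite_self]
    ring

theorem isHomogeneous_X_mul_pderiv [CommSemiring R] {P : MvPolynomial σ R} {n : ℕ}
    (hP : P.IsHomogeneous n) (i j : σ) : (X j * pderiv i P).IsHomogeneous n := by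
  cases n with
  | zero =>
    rw [← totalDegree_zero_iff_isHomogeneous, totalDegree_eq_zero_iff_eq_C] at hP
    rw [hP, pderiv_C, mul_zero]
    exact isHomogeneous_zero _ _ _
  | succ n => simpa only [add_comm, Nat.add_sub_cancel] using (isHomogeneous_X R j).mul hP.pderiv

theorem totalDegree_map_le_of_isHomogeneous [CommSemiring R]
    (T : Module.End R (MvPolynomial σ R))
    (hT : ∀ n P, P.IsHomogeneous n → (T P).IsHomogeneous n) (P : MvPolynomial σ R) :
    (T P).totalDegree ≤ P.totalDegree := by
  conv_lhs => rw [← sum_homogeneousComponent P, map_sum]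
  exact totalDegree_finsetSum_le fun n hn =>
    (hT n _ (homogeneousComponent_isHomogeneous n P)).totalDegree_le.trans
      (Finset.mem_range_succ_iff.1 hn)

theorem eval_smul_of_isHomogeneous [CommSemiring R] {P : MvPolynomial σ R} {n : ℕ}
    (hP : P.IsHomogeneous n) (r : R) (x : σ → R) : eval (r • x) P = r ^ n * eval x P := by
  rw [eval_eq, eval_eq, Finset.mul_sum]
  refine Finset.sum_congr rfl fun d hd => ?_
  have degree_eq : ∑ i ∈ d.support, d i = n := by
    rw [← hP (mem_support_iff.1 hd), Pi.one_def, ← Finsupp.degree_eq_weight_one]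
    rfl
  simp only [Pi.smul_apply, smul_eq_mul, mul_pow, Finset.prod_mul_distrib,
    Finset.prod_pow_eq_pow_sum, degree_eq]
  ring

end PolynomialDerivations

section EssentialSelfAdjointness

variable {𝕜 E F : Type*} [RCLike 𝕜] [NormedAddCommGroup E] [InnerProductSpace 𝕜 E]
  [NormedAddCommGroup F] [InnerProductSpace 𝕜 F]

theorem adjoint_topologicalClosure (g : Submodule 𝕜 (E × F)) :
    g.topologicalClosure.adjoint = g.adjoint := by
  ext x
  simp only [Submodule.mem_adjoint_iff]
  refine ⟨fun hx a b hab => hx a b (g.le_topologicalClosure hab), fun hx a b hab => ?_⟩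
  have isClosed_orthogonal :
      IsClosed {p : E × F | inner 𝕜 p.2 x.1 - inner 𝕜 p.1 x.2 = 0} :=
    isClosed_eq (by fun_prop) continuous_const
  exact closure_minimal (fun p hp => hx p.1 p.2 hp) isClosed_orthogonal hab

variable [CompleteSpace E]

theorem adjoint_closure {A : E →ₗ.[𝕜] F} (hdense : Dense (A.domain : Set E))
    (hA : A.IsClosable) : A.closure.adjoint = A.adjoint := by
  refine LinearPMap.eq_of_eq_graph ?_
  rw [LinearPMap.adjoint_graph_eq_graph_adjoint (hdense.mono A.le_closure.1),
    LinearPMap.adjoint_graph_eq_graph_adjoint hdense, ← hA.graph_closure_eq_closure_graph,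
    adjoint_topologicalClosure]

theorem isSelfAdjoint_closure_of_graph_adjoint_le {A : E →ₗ.[𝕜] E}
    (hdense : Dense (A.domain : Set E)) (hA : A.IsFormalAdjoint A)
    (hgraph : A.adjoint.graph ≤ A.graph.topologicalClosure) : IsSelfAdjoint A.closure := by
  have le_adjoint : A ≤ A.adjoint := hA.le_adjoint hdense
  have isClosed_adjoint : A.adjoint.IsClosed := LinearPMap.adjoint_isClosed hdense
  have isClosable : A.IsClosable := isClosed_adjoint.isClosable.leIsClosable le_adjoint
  have closure_eq_adjoint : A.closure = A.adjoint := by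
    refine LinearPMap.eq_of_eq_graph (le_antisymm ?_ ?_) <;>
      rw [← isClosable.graph_closure_eq_closure_graph]
    · exact Submodule.topologicalClosure_minimal _ (LinearPMap.le_graph_of_le le_adjoint)
        isClosed_adjoint
    · exact hgraph
  rw [LinearPMap.isSelfAdjoint_def, adjoint_closure hdense isClosable, closure_eq_adjoint]

theorem starProjection_mem_graph {A : E →ₗ.[𝕜] E} (hA : A.IsFormalAdjoint A)
    (hdense : Dense (A.domain : Set E)) {V : Submodule 𝕜 E} [V.HasOrthogonalProjection]
    (hdom : V ≤ A.domain) (hinv : ∀ x : A.domain, (x : E) ∈ V → A x ∈ V) {x y : E}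
    (hxy : (x, y) ∈ A.adjoint.graph) :
    (V.starProjection x, V.starProjection y) ∈ A.graph := by
  have hx : V.starProjection x ∈ V := Submodule.starProjection_apply_mem _ _
  refine A.mem_graph_iff.2 ⟨⟨_, hdom hx⟩, rfl, ?_⟩
  refine (Submodule.eq_starProjection_of_mem_of_inner_eq_zero (hinv _ hx) fun w hw => ?_).symm
  rw [LinearPMap.adjoint_graph_eq_graph_adjoint hdense, Submodule.mem_adjoint_iff] at hxy
  have hAw := hinv ⟨w, hdom hw⟩ hw
  have adjoint_pairing := hxy w (A ⟨w, hdom hw⟩) (A.mem_graph ⟨w, hdom hw⟩)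
  have symmetric_pairing := hA ⟨w, hdom hw⟩ ⟨_, hdom hx⟩
  have projection_pairing := Submodule.starProjection_inner_eq_zero (K := V) x _ hAw
  rw [inner_sub_left, sub_eq_zero] at projection_pairing ⊢
  rw [sub_eq_zero] at adjoint_pairing
  rw [← inner_conj_symm, ← inner_conj_symm _ w, ← adjoint_pairing, ← symmetric_pairing,
    inner_conj_symm, inner_conj_symm, projection_pairing]

/-- The restriction of the adjoint to `V n` is the compression of `A` to `V n`, so the projections
of a point of the graph of the adjoint to `V n × V n` lie in the graph of `A` and approximate it. -/
theorem isSelfAdjoint_closure_of_invariant {A : E →ₗ.[𝕜] E} (hA : A.IsFormalAdjoint A)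
    {V : ℕ → Submodule 𝕜 E} [∀ n, (V n).HasOrthogonalProjection] (hmono : Monotone V)
    (htop : ⊤ ≤ (⨆ n, V n).topologicalClosure) (hdom : ∀ n, V n ≤ A.domain)
    (hinv : ∀ n (x : A.domain), (x : E) ∈ V n → A x ∈ V n) : IsSelfAdjoint A.closure := by
  have hdense : Dense (A.domain : Set E) := fun x =>
    Submodule.topologicalClosure_mono (iSup_le hdom) (htop (Submodule.mem_top (x := x)))
  refine isSelfAdjoint_closure_of_graph_adjoint_le hdense hA fun ⟨x, y⟩ hxy => ?_
  exact mem_closure_of_tendsto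
    ((Submodule.starProjection_tendsto_self V hmono x htop).prodMk_nhds
      (Submodule.starProjection_tendsto_self V hmono y htop))
    (.of_forall fun n => starProjection_mem_graph hA hdense (hdom n) (hinv n) hxy)

end EssentialSelfAdjointness

section SmallestEigenvalue

variable {𝕜 E : Type*} [RCLike 𝕜] [NormedAddCommGroup E] [InnerProductSpace 𝕜 E]

theorem exists_isLeast_hasEigenvalue [FiniteDimensional 𝕜 E] [Nontrivial E] {T : Module.End 𝕜 E}
    (hT : T.IsSymmetric) :
    ∃ lam : ℝ, IsLeast {r : ℝ | T.HasEigenvalue (r : 𝕜)} lam ∧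
      ∀ x, lam * ‖x‖ ^ 2 ≤ RCLike.re (inner 𝕜 (T x) x) := by
  have bddBelow : BddBelow (Set.range fun x : {x : E // x ≠ 0} =>
      RCLike.re (inner 𝕜 (T x) (x : E)) / ‖(x : E)‖ ^ 2) := by
    refine ⟨-‖LinearMap.toContinuousLinearMap T‖, ?_⟩
    rintro _ ⟨x, rfl⟩
    exact (abs_le.1 ((LinearMap.toContinuousLinearMap T).rayleighQuotient_le_norm x)).1
  have infimum_mul_le : ∀ x, (⨅ x : {x : E // x ≠ 0}, RCLike.re (inner 𝕜 (T x) (x : E)) /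
      ‖(x : E)‖ ^ 2) * ‖x‖ ^ 2 ≤ RCLike.re (inner 𝕜 (T x) x) := by
    intro x
    rcases eq_or_ne x 0 with rfl | hx
    · simp
    · rw [← le_div_iff₀ (by positivity)]
      exact ciInf_le bddBelow ⟨x, hx⟩
  refine ⟨_, ⟨hT.hasEigenvalue_iInf_of_finiteDimensional, fun r hr => ?_⟩, infimum_mul_le⟩
  obtain ⟨x, hx⟩ := hr.exists_hasEigenvector
  refine le_of_mul_le_mul_right ((infimum_mul_le x).trans_eq ?_)
    (pow_pos (norm_pos_iff.2 hx.2) 2)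
  rw [hx.apply_eq_smul, inner_smul_left, inner_self_eq_norm_sq_to_K, RCLike.conj_ofReal]
  norm_cast

theorem exists_isLeast_hasEigenvalue_of_injective {V : Type*} [AddCommGroup V] [Module 𝕜 V]
    [FiniteDimensional 𝕜 V] [Nontrivial V] {ι : V →ₗ[𝕜] E} (hι : Function.Injective ι)
    {T : Module.End 𝕜 V} (hT : ∀ u v, inner 𝕜 (ι (T u)) (ι v) = inner 𝕜 (ι u) (ι (T v))) :
    ∃ lam : ℝ, IsLeast {r : ℝ | T.HasEigenvalue (r : 𝕜)} lam ∧
      ∀ u, lam * ‖ι u‖ ^ 2 ≤ RCLike.re (inner 𝕜 (ι (T u)) (ι u)) := by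
  let core : InnerProductSpace.Core 𝕜 V :=
    { inner u v := inner 𝕜 (ι u) (ι v)
      conj_inner_symm _ _ := inner_conj_symm _ _
      re_inner_nonneg _ := inner_self_nonneg
      add_left _ _ _ := by simp only [map_add, inner_add_left]
      smul_left _ _ _ := by simp only [map_smul, inner_smul_left]
      definite _ hu := hι (by rw [inner_self_eq_zero.1 hu, map_zero]) }
  let : NormedAddCommGroup V := core.toNormedAddCommGroup
  let : InnerProductSpace 𝕜 V := .ofCore core.toCore
  obtain ⟨lam, hleast, hle⟩ := exists_isLeast_hasEigenvalue (T := T) hT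
  refine ⟨lam, hleast, fun u => ?_⟩
  rw [← inner_self_eq_norm_sq (𝕜 := 𝕜)]
  exact inner_self_eq_norm_sq (𝕜 := 𝕜) u ▸ hle u

theorem hasEigenvalue_restrict_iff {R M : Type*} [CommRing R] [AddCommGroup M] [Module R M]
    {T : Module.End R M} {S : Submodule R M} (hS : ∀ u ∈ S, T u ∈ S) {r : R} :
    Module.End.HasEigenvalue (T.restrict hS) r ↔ ∃ u ∈ S, u ≠ 0 ∧ T u = r • u := by
  constructor
  · intro hr
    obtain ⟨u, hu⟩ := hr.exists_hasEigenvector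
    exact ⟨u, u.2, by simpa using hu.2, congrArg Subtype.val hu.apply_eq_smul⟩
  · rintro ⟨u, hu, hu0, hTu⟩
    exact Module.End.hasEigenvalue_of_hasEigenvector (x := ⟨u, hu⟩)
      (Module.End.hasEigenvector_iff.2
        ⟨Module.End.mem_eigenspace_iff.2 (Subtype.ext hTu), by simpa using hu0⟩)

end SmallestEigenvalue

open MvPolynomial

section Adjoint

theorem mul_dz_add_conj_mul_dzbar (j : Fin 2) (F : C2 → ℂ) (z : C2) (a : ℂ) :
    a * dz j F z + conj a * dzbar j F z = fderiv ℝ F z (EuclideanSpace.single j a) := by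
  have single_eq : EuclideanSpace.single j a =
      a.re • EuclideanSpace.single j (1 : ℂ) + a.im • EuclideanSpace.single j Complex.I := by
    ext i
    by_cases hi : i = j <;> simp [hi, Complex.re_add_im]
  have hconj : conj a = a.re - a.im * Complex.I := Complex.ext (by simp) (by simp)
  rw [single_eq, map_add, map_smul, map_smul, hconj, dz, dzbar, Complex.real_smul,
    Complex.real_smul]
  linear_combination -(1 / 2 * (fderiv ℝ F z (EuclideanSpace.single j 1)
      - Complex.I * fderiv ℝ F z (EuclideanSpace.single j Complex.I))) * Complex.re_add_im a -
    a.im * fderiv ℝ F z (EuclideanSpace.single j Complex.I) * Complex.I_sq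

theorem fderiv_eq_wirtinger (F : C2 → ℂ) (z v : C2) :
    fderiv ℝ F z v = v 0 * dz 0 F z + conj (v 0) * dzbar 0 F z
      + (v 1 * dz 1 F z + conj (v 1) * dzbar 1 F z) := by
  rw [mul_dz_add_conj_mul_dzbar, mul_dz_add_conj_mul_dzbar, ← map_add]
  congr 1
  ext j
  fin_cases j <;> simp

/-- The real vector field `z ↦ c (-z̄₂, z̄₁)`; for `c = a + ib` it is a combination of the real
and imaginary parts of `𝓛`. -/
def quat (c : ℂ) : C2 →ₗ[ℝ] C2 where
  toFun z := !₂[-(c * conj (z 1)), c * conj (z 0)]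
  map_add' x y := by
    ext j
    fin_cases j <;> simp <;> ring
  map_smul' r x := by
    ext j
    fin_cases j <;> simp <;> ring

@[simp] theorem quat_apply_zero (c : ℂ) (z : C2) : quat c z 0 = -(c * conj (z 1)) := rfl

@[simp] theorem quat_apply_one (c : ℂ) (z : C2) : quat c z 1 = c * conj (z 0) := rfl

theorem norm_quat (c : ℂ) (z : C2) : ‖quat c z‖ = ‖c‖ * ‖z‖ := by
  rw [← sq_eq_sq₀ (by positivity) (by positivity), mul_pow, EuclideanSpace.norm_sq_eq,
    EuclideanSpace.norm_sq_eq, Fin.sum_univ_two, Fin.sum_univ_two]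
  simp only [quat_apply_zero, quat_apply_one, norm_neg, norm_mul, RCLike.norm_conj]
  ring

theorem quat_quat (c : ℂ) (z : C2) : quat c (quat c z) = -(‖c‖ ^ 2) • z := by
  have hc : c * conj c = (‖c‖ : ℂ) ^ 2 := Complex.mul_conj' c
  ext j
  fin_cases j
  · change -(c * conj (c * conj (z 0))) = -(‖c‖ ^ 2) • z 0
    rw [map_mul, Complex.conj_conj, Complex.real_smul]
    push_cast
    linear_combination -(z 0) * hc
  · change c * conj (-(c * conj (z 1))) = -(‖c‖ ^ 2) • z 1
    rw [map_neg, map_mul, Complex.conj_conj, Complex.real_smul]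
    push_cast
    linear_combination -(z 1) * hc

variable {c : ℂ}

/-- `quat c` for `|c| = 1` as a linear isometry, so that `rotation` provides its flow. -/
def quatIsometry (hc : ‖c‖ = 1) : C2 →ₗᵢ[ℝ] C2 :=
  ⟨quat c, fun z => by rw [norm_quat, hc, one_mul]⟩

theorem quatIsometry_quatIsometry (hc : ‖c‖ = 1) (z : C2) :
    quatIsometry hc (quatIsometry hc z) = -z :=
  (quat_quat c z).trans (by simp [hc])

/-- The flow of the vector field `quat c` on `𝕊³`. -/
def quatFlow (hc : ‖c‖ = 1) (s : ℝ) : S3 → S3 :=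
  sphereMap (rotation (quatIsometry_quatIsometry hc) s)

theorem quatFlow_zero (hc : ‖c‖ = 1) (z : S3) : quatFlow hc 0 z = z :=
  Subtype.ext (rotation_zero _ _)

theorem hasDerivAt_quatFlow (hc : ‖c‖ = 1) (z : S3) (s : ℝ) :
    HasDerivAt (fun s => (quatFlow hc s z : C2)) (quat c (quatFlow hc s z)) s :=
  hasDerivAt_rotation (quatIsometry_quatIsometry hc) s (z : C2)

/-- The derivative along the real vector field `quat c`. -/
def quatDeriv (c : ℂ) : Module.End ℂ Smooth := c • L + conj c • Lbar

theorem quatDeriv_apply (c : ℂ) (f : Smooth) : quatDeriv c f = c • L f + conj c • Lbar f := rfl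

theorem quatDeriv_eq_fderiv (c : ℂ) (f : Smooth) (z : S3) :
    (quatDeriv c f).1 z = fderiv ℝ (ext f.1) z (quat c z) := by
  change c * (conj ((z : C2) 0) * dz 1 (ext f.1) z - conj ((z : C2) 1) * dz 0 (ext f.1) z) +
    conj c * ((z : C2) 0 * dzbar 1 (ext f.1) z - (z : C2) 1 * dzbar 0 (ext f.1) z) = _
  rw [fderiv_eq_wirtinger]
  simp only [quat_apply_zero, quat_apply_one, map_neg, map_mul, Complex.conj_conj]
  ring

theorem hasDerivAt_comp_quatFlow (hc : ‖c‖ = 1) (f : Smooth) (z : S3) (s : ℝ) :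
    HasDerivAt (fun s => f.1 (quatFlow hc s z)) ((quatDeriv c f).1 (quatFlow hc s z)) s := by
  rw [quatDeriv_eq_fderiv]
  have deriv_ext := (ext_differentiableAt f.2 (quatFlow hc s z)).hasFDerivAt.comp_hasDerivAt s
    (hasDerivAt_quatFlow hc z s)
  refine deriv_ext.congr_of_eventuallyEq (.of_forall fun r => ?_)
  exact (ext_coe f.1 (quatFlow hc r z)).symm

theorem continuous_coe (f : Smooth) : Continuous f.1 := ContMDiff.continuous f.2

theorem inner_toL2 (f g : Smooth) :
    inner ℂ (toL2 f) (toL2 g) = ∫ z, g.1 z * conj (f.1 z) ∂sigma :=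
  ContinuousMap.inner_toLp sigma _ _

theorem continuous_mul_conj (f g : Smooth) : Continuous fun z => g.1 z * conj (f.1 z) :=
  (continuous_coe g).mul (Complex.continuous_conj.comp (continuous_coe f))

theorem inner_quatDeriv (hc : ‖c‖ = 1) (f g : Smooth) :
    inner ℂ (toL2 (quatDeriv c f)) (toL2 g) = -inner ℂ (toL2 f) (toL2 (quatDeriv c g)) := by
  have integrable : ∀ u v : Smooth, Integrable (fun z => v.1 z * conj (u.1 z)) sigma :=
    fun u v => (continuous_mul_conj u v).integrable_of_hasCompactSupport
      (HasCompactSupport.of_compactSpace _)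
  have integral_deriv := integral_deriv_flow_eq_zero (μ := sigma)
    (fun s => continuous_sphereMap _)
    (fun s => measurePreserving_sphereMap _ (LinearIsometryEquiv.measurePreserving _))
    (continuous_mul_conj f g)
    ((continuous_mul_conj f (quatDeriv c g)).add (continuous_mul_conj (quatDeriv c f) g))
    fun z s => (hasDerivAt_comp_quatFlow hc g z s).mul (hasDerivAt_comp_quatFlow hc f z s).star
  rw [inner_toL2, inner_toL2, eq_neg_iff_add_eq_zero, add_comm,
    ← integral_add (integrable _ _) (integrable _ _)]
  exact integral_deriv

theorem inner_L (f g : Smooth) :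
    inner ℂ (toL2 (L f)) (toL2 g) = -inner ℂ (toL2 f) (toL2 (Lbar g)) := by
  have real_part := inner_quatDeriv (c := 1) (by simp) f g
  have imag_part := inner_quatDeriv (c := Complex.I) (by simp) f g
  simp only [quatDeriv_apply, map_add, map_smul, inner_add_left, inner_add_right,
    inner_smul_left, inner_smul_right, Complex.conj_I, map_one, map_neg] at real_part imag_part
  linear_combination (1 / 2 : ℂ) * real_part + (Complex.I / 2) * imag_part +
    (1 / 2 : ℂ) * (inner ℂ (toL2 (L f)) (toL2 g) - inner ℂ (toL2 (Lbar f)) (toL2 g)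
    - inner ℂ (toL2 f) (toL2 (L g)) + inner ℂ (toL2 f) (toL2 (Lbar g))) * Complex.I_mul_I

theorem inner_Lbar (f g : Smooth) :
    inner ℂ (toL2 (Lbar f)) (toL2 g) = -inner ℂ (toL2 f) (toL2 (L g)) := by
  rw [← inner_conj_symm, ← inner_conj_symm (toL2 f), inner_L g f, map_neg, neg_neg]

theorem Lt_apply (t : ℂ) (f : Smooth) : Lt t f = L f + conj t • Lbar f := rfl

theorem Ltbar_apply (t : ℂ) (f : Smooth) : Ltbar t f = Lbar f + t • L f := rfl

theorem box_apply (t : ℂ) (f : Smooth) : box t f = -((h t : ℂ) • Lt t (Ltbar t f)) := by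
  simp only [box, LinearMap.neg_apply, Module.End.mul_apply, LinearMap.smul_apply, map_smul]

theorem inner_Ltbar (t : ℂ) (f g : Smooth) :
    inner ℂ (toL2 (Ltbar t f)) (toL2 g) = -inner ℂ (toL2 f) (toL2 (Lt t g)) := by
  simp only [Ltbar_apply, Lt_apply, map_add, map_smul, inner_add_left, inner_add_right,
    inner_smul_left, inner_smul_right, inner_L, inner_Lbar]
  ring

theorem inner_box_right (t : ℂ) (f g : Smooth) :
    inner ℂ (toL2 f) (toL2 (box t g)) =
      (h t : ℂ) * inner ℂ (toL2 (Ltbar t f)) (toL2 (Ltbar t g)) := by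
  rw [box_apply, map_neg, map_smul, inner_neg_right, inner_smul_right, inner_Ltbar]
  ring

theorem inner_box_left (t : ℂ) (f g : Smooth) :
    inner ℂ (toL2 (box t f)) (toL2 g) = inner ℂ (toL2 f) (toL2 (box t g)) := by
  rw [← inner_conj_symm, inner_box_right, inner_box_right, map_mul, inner_conj_symm,
    Complex.conj_ofReal]

end Adjoint

section Polynomials

theorem contDiff_value (P : Poly) : ContDiff ℝ ∞ (Poly.value P) := by
  have contDiff_coordinate : ∀ i, ContDiff ℝ ∞ fun z : C2 =>
      Sum.elim (fun i => z i) (fun i => conj (z i)) i := by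
    rintro (i | i)
    exacts [contDiff_coord i, contDiff_conj_coord i]
  change ContDiff ℝ ∞ fun z : C2 => eval (Sum.elim (fun i => z i) fun i => conj (z i)) P
  simp only [eval_eq']
  exact ContDiff.sum fun d _ => contDiff_const.mul
    (contDiff_prod fun i _ => (contDiff_coordinate i).pow _)

/-- The restriction of a polynomial in `z, z̄` to the sphere. -/
def res : Poly →ₗ[ℂ] Smooth where
  toFun P := ⟨fun z => P.value z, restrict_smooth (contDiff_value P).contDiffOn⟩
  map_add' P Q := by ext z; simp [Poly.value]
  map_smul' c P := by ext z; simp [Poly.value]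

theorem res_apply (P : Poly) (z : S3) : (res P).1 z = P.value z := rfl

/-- The derivation `𝓛` on polynomials. -/
def Lpoly : Derivation ℂ Poly Poly :=
  (X (Sum.inr 0) : Poly) • pderiv (Sum.inl 1) - (X (Sum.inr 1) : Poly) • pderiv (Sum.inl 0)

/-- The derivation `𝓛̄` on polynomials. -/
def Lbarpoly : Derivation ℂ Poly Poly :=
  (X (Sum.inl 0) : Poly) • pderiv (Sum.inr 1) - (X (Sum.inl 1) : Poly) • pderiv (Sum.inr 0)

theorem Lpoly_apply (P : Poly) : Lpoly P =
    X (Sum.inr 0) * pderiv (Sum.inl 1) P - X (Sum.inr 1) * pderiv (Sum.inl 0) P := rfl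

theorem Lbarpoly_apply (P : Poly) : Lbarpoly P =
    X (Sum.inl 0) * pderiv (Sum.inr 1) P - X (Sum.inl 1) * pderiv (Sum.inr 0) P := rfl

theorem hasDerivAt_value (P : Poly) {γ : ℝ → C2} {v : C2} {s : ℝ} (hγ : HasDerivAt γ v s) :
    HasDerivAt (fun s => P.value (γ s))
      (∑ i, v i * Poly.value (pderiv (Sum.inl i) P) (γ s) +
        ∑ i, conj (v i) * Poly.value (pderiv (Sum.inr i) P) (γ s)) s := by
  have hasDerivAt_coord : ∀ i, HasDerivAt (fun s => γ s i) (v i) s := fun i =>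
    ((EuclideanSpace.proj (𝕜 := ℂ) i).restrictScalars ℝ).hasFDerivAt.comp_hasDerivAt s hγ
  have key := hasDerivAt_eval (x := fun s => Sum.elim (fun i => γ s i) fun i => conj (γ s i))
    (x' := Sum.elim (fun i => v i) fun i => conj (v i)) (s := s)
    (by rintro (i | i); exacts [hasDerivAt_coord i, (hasDerivAt_coord i).star]) P
  rw [Fintype.sum_sum_type] at key
  exact key

theorem quatDeriv_res {c : ℂ} (hc : ‖c‖ = 1) (P : Poly) :
    quatDeriv c (res P) = res (c • Lpoly P + conj c • Lbarpoly P) := by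
  ext z
  have deriv_flow := hasDerivAt_comp_quatFlow hc (res P) z 0
  have deriv_value := hasDerivAt_value P (hasDerivAt_quatFlow hc z 0)
  simp only [quatFlow_zero] at deriv_flow deriv_value
  rw [deriv_flow.unique deriv_value, res_apply]
  simp only [Fin.sum_univ_two, quat_apply_zero, quat_apply_one, map_neg, map_mul,
    Complex.conj_conj, Lpoly_apply, Lbarpoly_apply, Poly.value, map_add, map_sub,
    smul_eval, eval_X, Sum.elim_inl, Sum.elim_inr]
  ring

theorem L_res (P : Poly) : L (res P) = res (Lpoly P) := by
  have real_part := quatDeriv_res (c := 1) (by simp) P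
  have imag_part := quatDeriv_res (c := Complex.I) (by simp) P
  simp only [quatDeriv_apply, map_add, map_smul, map_one, Complex.conj_I]
    at real_part imag_part
  replace imag_part := congrArg (Complex.I • ·) imag_part
  simp only [smul_add, smul_smul, mul_neg, Complex.I_mul_I] at imag_part
  linear_combination (norm := module) (1 / 2 : ℂ) • real_part - (1 / 2 : ℂ) • imag_part

theorem Lbar_res (P : Poly) : Lbar (res P) = res (Lbarpoly P) := by
  have real_part := quatDeriv_res (c := 1) (by simp) P
  simp only [quatDeriv_apply, map_add, map_one, one_smul, L_res] at real_part
  exact add_left_cancel real_part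

/-- The restriction of polynomials to the sphere as a homomorphism of algebras, as needed for the
Stone-Weierstrass theorem. -/
def continuousRes : Poly →ₐ[ℂ] C(S3, ℂ) :=
  aeval (Sum.elim (fun i => ⟨fun z => (z : C2) i, by fun_prop⟩)
    (fun i => ⟨fun z => conj ((z : C2) i), by fun_prop⟩))

theorem continuousRes_apply (P : Poly) (z : S3) : continuousRes P z = P.value z := by
  have comp_eval : (ContinuousMap.evalAlgHom ℂ ℂ z).comp continuousRes =
      aeval (Sum.elim (fun i => (z : C2) i) (fun i => conj ((z : C2) i))) := by
    apply algHom_ext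
    rintro (i | i) <;> simp [continuousRes]
  have apply_eq := DFunLike.congr_fun comp_eval P
  rw [aeval_eq_eval] at apply_eq
  exact apply_eq

theorem denseRange_continuousRes : DenseRange continuousRes := by
  let coords : Set C(S3, ℂ) := Set.range fun i : Fin 2 => continuousRes (X (Sum.inl i))
  have separates : (StarAlgebra.adjoin ℂ coords).SeparatesPoints := by
    intro z w hzw
    by_contra hcon
    apply hzw
    ext i
    by_contra hi
    refine hcon ⟨_, ⟨continuousRes (X (Sum.inl i)),
      StarAlgebra.subset_adjoin ℂ coords ⟨i, rfl⟩, rfl⟩, ?_⟩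
    simpa [continuousRes_apply, Poly.value] using hi
  have adjoin_le : (StarAlgebra.adjoin ℂ coords).toSubalgebra ≤ continuousRes.range := by
    rw [StarAlgebra.adjoin_toSubalgebra, Algebra.adjoin_le_iff]
    rintro g (⟨i, rfl⟩ | ⟨i, hi⟩)
    · exact ⟨_, rfl⟩
    · refine ⟨X (Sum.inr i), star_injective ?_⟩
      rw [← hi]
      ext z
      simp [continuousRes_apply, Poly.value]
  intro g
  have hg : g ∈ (StarAlgebra.adjoin ℂ coords).topologicalClosure := by
    rw [ContinuousMap.starSubalgebra_topologicalClosure_eq_top_of_separatesPoints _ separates]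
    trivial
  exact closure_mono (s := (StarAlgebra.adjoin ℂ coords : Set C(S3, ℂ))) adjoin_le hg

theorem denseRange_toL2_res : DenseRange fun P : Poly => toL2 (res P) := by
  have := (ContinuousMap.toLp_denseRange ℂ sigma ℂ (p := 2) (by simp)).comp
    denseRange_continuousRes (ContinuousMap.toLp 2 sigma ℂ).continuous
  convert this using 1
  funext P
  refine congrArg (ContinuousMap.toLp 2 sigma ℂ) ?_
  ext z
  exact (continuousRes_apply P z).symm

end Polynomials

section SelfAdjoint

theorem isHomogeneous_Lpoly {P : Poly} {n : ℕ} (hP : P.IsHomogeneous n) :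
    (Lpoly P).IsHomogeneous n :=
  (isHomogeneous_X_mul_pderiv hP _ _).sub (isHomogeneous_X_mul_pderiv hP _ _)

theorem isHomogeneous_Lbarpoly {P : Poly} {n : ℕ} (hP : P.IsHomogeneous n) :
    (Lbarpoly P).IsHomogeneous n :=
  (isHomogeneous_X_mul_pderiv hP _ _).sub (isHomogeneous_X_mul_pderiv hP _ _)

/-- The Kohn Laplacian on polynomials. -/
def boxPoly (t : ℂ) : Module.End ℂ Poly :=
  -((h t : ℂ) • (Lpoly.toLinearMap + conj t • Lbarpoly.toLinearMap) *
    (Lbarpoly.toLinearMap + t • Lpoly.toLinearMap))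

theorem boxPoly_apply (t : ℂ) (P : Poly) :
    boxPoly t P = -((h t : ℂ) • (Lpoly (Lbarpoly P + t • Lpoly P) +
      conj t • Lbarpoly (Lbarpoly P + t • Lpoly P))) := rfl

theorem box_res (t : ℂ) (P : Poly) : box t (res P) = res (boxPoly t P) := by
  simp only [box_apply, boxPoly_apply, Lt_apply, Ltbar_apply, L_res, Lbar_res, ← map_smul,
    ← map_add, ← map_neg]

theorem isHomogeneous_boxPoly (t : ℂ) {n : ℕ} {P : Poly} (hP : P.IsHomogeneous n) :
    (boxPoly t P).IsHomogeneous n := by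
  have smul_mem : ∀ (c : ℂ) {Q : Poly}, Q.IsHomogeneous n → (c • Q).IsHomogeneous n :=
    fun c _ hQ => (homogeneousSubmodule _ _ n).smul_mem c hQ
  have hLtbar : (Lbarpoly P + t • Lpoly P).IsHomogeneous n :=
    (isHomogeneous_Lbarpoly hP).add (smul_mem t (isHomogeneous_Lpoly hP))
  exact (smul_mem _ ((isHomogeneous_Lpoly hLtbar).add
    (smul_mem _ (isHomogeneous_Lbarpoly hLtbar)))).neg

theorem toL2_mem_domain (t : ℂ) (f : Smooth) : toL2 f ∈ (boxSmooth t).domain := ⟨f, rfl⟩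

theorem boxSmooth_toL2 (t : ℂ) (f : Smooth) :
    boxSmooth t ⟨toL2 f, toL2_mem_domain t f⟩ = toL2 (box t f) :=
  congrArg (fun g => toL2 (box t g))
    ((LinearEquiv.symm_apply_eq (LinearEquiv.ofInjective toL2 toL2_injective)).2 rfl)

theorem isFormalAdjoint_boxSmooth (t : ℂ) : (boxSmooth t).IsFormalAdjoint (boxSmooth t) := by
  rintro ⟨_, f, rfl⟩ ⟨_, g, rfl⟩
  exact (congrArg (inner ℂ · (toL2 g)) (boxSmooth_toL2 t f)).trans
    ((inner_box_left t f g).trans (congrArg (inner ℂ (toL2 f)) (boxSmooth_toL2 t g).symm))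

/-- The restrictions to `𝕊³` of the polynomials of degree at most `n`, as a subspace of
`L²(𝕊³)`. -/
def polySubspace (n : ℕ) : Submodule ℂ L2S3 :=
  (restrictTotalDegree (Fin 2 ⊕ Fin 2) ℂ n).map (toL2 ∘ₗ res)

theorem mem_polySubspace {n : ℕ} {u : L2S3} :
    u ∈ polySubspace n ↔ ∃ P : Poly, P.totalDegree ≤ n ∧ toL2 (res P) = u := by
  simp only [polySubspace, Submodule.mem_map, mem_restrictTotalDegree, LinearMap.comp_apply]

instance (n : ℕ) : FiniteDimensional ℂ (polySubspace n) := by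
  unfold polySubspace
  infer_instance

theorem monotone_polySubspace : Monotone polySubspace := by
  intro m n hmn u hu
  obtain ⟨P, hP, rfl⟩ := mem_polySubspace.1 hu
  exact mem_polySubspace.2 ⟨P, hP.trans hmn, rfl⟩

theorem topologicalClosure_iSup_polySubspace : ⊤ ≤ (⨆ n, polySubspace n).topologicalClosure := by
  intro u _
  refine closure_mono ?_ (denseRange_toL2_res u)
  rintro _ ⟨P, rfl⟩
  exact Submodule.mem_iSup_of_mem _ (mem_polySubspace.2 ⟨P, le_rfl, rfl⟩)

theorem isSelfAdjoint_boxL2 (t : ℂ) : IsSelfAdjoint (boxL2 t) := by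
  refine isSelfAdjoint_closure_of_invariant (isFormalAdjoint_boxSmooth t) monotone_polySubspace
    topologicalClosure_iSup_polySubspace (fun n u hu => ?_) fun n ⟨u, hdom⟩ hu => ?_
  · obtain ⟨P, -, rfl⟩ := mem_polySubspace.1 hu
    exact toL2_mem_domain t (res P)
  · obtain ⟨P, hP, rfl⟩ := mem_polySubspace.1 hu
    refine mem_polySubspace.2 ⟨boxPoly t P, ?_, ?_⟩
    · exact (totalDegree_map_le_of_isHomogeneous (boxPoly t)
        (fun _ _ hQ => isHomogeneous_boxPoly t hQ) P).trans hP
    · rw [← box_res, ← boxSmooth_toL2]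

theorem mem_spec_boxL2 {t lam : ℂ} {f : Smooth} (hf : f ≠ 0) (hlam : box t f = lam • f) :
    lam ∈ spec (boxL2 t) := by
  rintro ⟨R, hR, -⟩
  have le_boxL2 : boxSmooth t ≤ boxL2 t := (boxSmooth t).le_closure
  have boxL2_apply : boxL2 t ⟨toL2 f, le_boxL2.1 (toL2_mem_domain t f)⟩ = lam • toL2 f := by
    rw [← map_smul, ← hlam, ← boxSmooth_toL2]
    exact (le_boxL2.2 rfl).symm
  have resolvent_apply := hR ⟨toL2 f, le_boxL2.1 (toL2_mem_domain t f)⟩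
  rw [boxL2_apply, sub_self, map_zero] at resolvent_apply
  change 0 = toL2 f at resolvent_apply
  exact hf (toL2_injective (by rw [← resolvent_apply, map_zero]))

end SelfAdjoint

section Antipode

/-- The pull back of functions on `𝕊³` along the antipodal map. -/
def antipode : Module.End ℂ Smooth where
  toFun f := ⟨fun z => f.1 (-z), ContMDiff.comp (I' := 𝓡 3) f.2 (contMDiff_neg_sphere (n := 3))⟩
  map_add' _ _ := rfl
  map_smul' _ _ := rfl

theorem antipode_apply (f : Smooth) (z : S3) : (antipode f).1 z = f.1 (-z) := rfl

theorem antipode_antipode (f : Smooth) : antipode (antipode f) = f := by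
  ext z
  rw [antipode_apply, antipode_apply, neg_neg]

theorem inner_antipode (f g : Smooth) :
    inner ℂ (toL2 (antipode f)) (toL2 (antipode g)) = inner ℂ (toL2 f) (toL2 g) := by
  have hneg := measurePreserving_sphereMap (μ := volume) (LinearIsometryEquiv.neg ℝ (E := C2))
    (LinearIsometryEquiv.measurePreserving _)
  rw [inner_toL2, inner_toL2]
  conv_rhs => rw [sigma, ← hneg.map_eq]
  rw [integral_map hneg.measurable.aemeasurable (continuous_mul_conj f g).aestronglyMeasurable]
  rfl

theorem inner_antipode_right (f g : Smooth) :
    inner ℂ (toL2 f) (toL2 (antipode g)) = inner ℂ (toL2 (antipode f)) (toL2 g) := by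
  rw [← inner_antipode, antipode_antipode]

theorem antipode_res {P : Poly} {n : ℕ} (hP : P.IsHomogeneous n) :
    antipode (res P) = (-1 : ℂ) ^ n • res P := by
  ext z
  refine Eq.trans ?_ (eval_smul_of_isHomogeneous hP (-1 : ℂ) _)
  rw [antipode_apply, res_apply, Poly.value]
  congr 2
  funext i
  rcases i with i | i <;> simp

end Antipode

section EigenForms

theorem derivation_prod_pow {R A ι : Type*} [CommSemiring R] [CommSemiring A] [Algebra R A]
    (D : Derivation R A A) {x : ι → A} {α : ι → R} (hx : ∀ i, D (x i) = α i • x i)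
    (s : Finset ι) (d : ι → ℕ) :
    D (∏ i ∈ s, x i ^ d i) = (∑ i ∈ s, d i * α i) • ∏ i ∈ s, x i ^ d i := by
  classical
  have apply_pow : ∀ i (n : ℕ), D (x i ^ n) = (n * α i) • x i ^ n := by
    rintro i (_ | n)
    · simp
    · rw [D.leibniz_pow, hx, Nat.add_sub_cancel, nsmul_eq_mul]
      simp only [smul_eq_mul, Algebra.smul_def, map_mul, map_natCast]
      ring
  induction s using Finset.induction_on with
  | empty => simp
  | insert i s hi ih =>
    rw [Finset.prod_insert hi, Finset.sum_insert hi, D.leibniz, ih, apply_pow]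
    rw [smul_eq_mul, smul_eq_mul]
    simp only [Algebra.smul_def, map_add]
    ring

/-- The derivation `𝓛_t` on polynomials. -/
def Ltpoly (t : ℂ) : Derivation ℂ Poly Poly := Lpoly + conj t • Lbarpoly

theorem Ltpoly_apply (t : ℂ) (P : Poly) : Ltpoly t P = Lpoly P + conj t • Lbarpoly P := rfl

theorem Lt_res (t : ℂ) (P : Poly) : Lt t (res P) = res (Ltpoly t P) := by
  rw [Lt_apply, L_res, Lbar_res, Ltpoly_apply, map_add, map_smul]

/-- The signs of the eigenvalues of `𝓛_t` on the linear forms `eigenForm a`, in units of `a`. -/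
def eigenSign : Fin 2 ⊕ Fin 2 → ℤ := Sum.elim ![-1, 1] ![1, -1]

/-- The linear forms `z̄₂ ± a z₁` and `z̄₁ ± a z₂`: for `a² = -t̄` they are eigenvectors of `𝓛_t`,
with eigenvalues `∓ a` and `± a`, respectively. -/
def eigenForm (a : ℂ) : Fin 2 ⊕ Fin 2 → Poly :=
  Sum.elim ![X (Sum.inr 1) + a • X (Sum.inl 0), X (Sum.inr 1) - a • X (Sum.inl 0)]
    ![X (Sum.inr 0) + a • X (Sum.inl 1), X (Sum.inr 0) - a • X (Sum.inl 1)]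

theorem isHomogeneous_eigenForm (a : ℂ) (i : Fin 2 ⊕ Fin 2) : (eigenForm a i).IsHomogeneous 1 := by
  have smul_mem : ∀ j, (a • X j : Poly).IsHomogeneous 1 :=
    fun j => (homogeneousSubmodule _ _ 1).smul_mem a (isHomogeneous_X ℂ _)
  rcases i with i | i <;> fin_cases i
  exacts [(isHomogeneous_X ℂ _).add (smul_mem _), (isHomogeneous_X ℂ _).sub (smul_mem _),
    (isHomogeneous_X ℂ _).add (smul_mem _), (isHomogeneous_X ℂ _).sub (smul_mem _)]

theorem Ltpoly_eigenForm {t a : ℂ} (ha : a ^ 2 = -conj t) (i : Fin 2 ⊕ Fin 2) :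
    Ltpoly t (eigenForm a i) = (eigenSign i * a) • eigenForm a i := by
  have ht : conj t = -a ^ 2 := by rw [ha, neg_neg]
  rw [Ltpoly_apply, Lpoly_apply, Lbarpoly_apply, ht]
  rcases i with i | i <;> fin_cases i <;>
    simp [eigenForm, eigenSign, pderiv_X] <;> module

theorem Ltpoly_prod_eigenForm {t a : ℂ} (ha : a ^ 2 = -conj t) (d : Fin 2 ⊕ Fin 2 → ℕ) :
    Ltpoly t (∏ i, eigenForm a i ^ d i) =
      ((∑ i, d i * eigenSign i : ℤ) * a) • ∏ i, eigenForm a i ^ d i := by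
  rw [derivation_prod_pow (Ltpoly t) (Ltpoly_eigenForm ha)]
  push_cast
  simp only [Finset.sum_mul, mul_assoc]

theorem sum_mul_eigenSign_ne_zero {d : Fin 2 ⊕ Fin 2 → ℕ} (hd : Odd (∑ i, d i)) :
    ∑ i, d i * eigenSign i ≠ 0 := by
  obtain ⟨r, hr⟩ := hd
  simp only [Fintype.sum_sum_type, Fin.sum_univ_two, eigenSign, Sum.elim_inl, Sum.elim_inr,
    Matrix.cons_val_zero, Matrix.cons_val_one] at hr ⊢
  omega

theorem aeval_eigenForm_surjective {a : ℂ} (ha : a ≠ 0) :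
    Function.Surjective (aeval (R := ℂ) (eigenForm a)) := by
  rw [← AlgHom.range_eq_top, ← top_le_iff, ← adjoin_range_X, Algebra.adjoin_le_iff]
  rintro _ ⟨i, rfl⟩
  set S := (aeval (R := ℂ) (eigenForm a)).range
  have form_mem : ∀ i, eigenForm a i ∈ S := fun i => ⟨X i, aeval_X _ _⟩
  have left_mem : ∀ w z, w + a • z ∈ S → w - a • z ∈ S → w ∈ S := fun w z hadd hsub => by
    have half_sum : (1 / 2 : ℂ) • ((w + a • z) + (w - a • z)) = w := by module
    exact half_sum ▸ S.smul_mem (add_mem hadd hsub) _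
  have right_mem : ∀ w z, w + a • z ∈ S → w - a • z ∈ S → z ∈ S := fun w z hadd hsub => by
    have half_diff : (1 / (2 * a)) • ((w + a • z) - (w - a • z)) = z := by
      match_scalars <;> field_simp <;> ring
    exact half_diff ▸ S.smul_mem (sub_mem hadd hsub) _
  rcases i with i | i <;> fin_cases i
  exacts [right_mem _ _ (form_mem (Sum.inl 0)) (form_mem (Sum.inl 1)),
    right_mem _ _ (form_mem (Sum.inr 0)) (form_mem (Sum.inr 1)),
    left_mem _ _ (form_mem (Sum.inr 0)) (form_mem (Sum.inr 1)),
    left_mem _ _ (form_mem (Sum.inl 0)) (form_mem (Sum.inl 1))]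

theorem antipode_eq_self_of_Ltbar_eq_zero {t : ℂ} (ht : t ≠ 0) {g : Smooth}
    (hg : Ltbar t g = 0) : antipode g = g := by
  obtain ⟨a, ha⟩ := IsAlgClosed.exists_pow_nat_eq (-conj t) (n := 2) (by norm_num)
  have ha0 : a ≠ 0 := by
    rintro rfl
    exact ht (by simpa using ha.symm)
  have inner_Lt : ∀ P : Poly, inner ℂ (toL2 (res (Ltpoly t P))) (toL2 g) = 0 := fun P => by
    rw [← Lt_res, ← neg_eq_zero, ← inner_conj_symm, ← map_neg, ← inner_Ltbar, hg, map_zero,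
      inner_zero_left, map_zero]
  have inner_monomial : ∀ d : Fin 2 ⊕ Fin 2 → ℕ,
      inner ℂ (toL2 (res (∏ i, eigenForm a i ^ d i))) (toL2 (antipode g)) =
        inner ℂ (toL2 (res (∏ i, eigenForm a i ^ d i))) (toL2 g) := fun d => by
    have homogeneous : (∏ i, eigenForm a i ^ d i).IsHomogeneous (∑ i, d i) :=
      IsHomogeneous.prod _ _ _ fun i _ => by
        simpa only [one_mul] using (isHomogeneous_eigenForm a i).pow (d i)
    rw [inner_antipode_right, antipode_res homogeneous]
    rcases Nat.even_or_odd (∑ i, d i) with heven | hodd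
    · rw [heven.neg_one_pow, one_smul]
    · have orthogonal := inner_Lt (∏ i, eigenForm a i ^ d i)
      rw [Ltpoly_prod_eigenForm ha, map_smul, map_smul, inner_smul_left, mul_eq_zero, map_eq_zero,
        or_iff_right (mul_ne_zero (Int.cast_ne_zero.2 (sum_mul_eigenSign_ne_zero hodd)) ha0)]
        at orthogonal
      rw [map_smul, inner_smul_left, orthogonal, mul_zero]
  refine toL2_injective (denseRange_toL2_res.eq_of_inner_right ℂ fun P => ?_)
  obtain ⟨Q, rfl⟩ := aeval_eigenForm_surjective ha0 P
  induction Q using MvPolynomial.induction_on' with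
  | monomial d c =>
    rw [aeval_monomial, Finsupp.prod_fintype _ _ fun _ => pow_zero _, ← Algebra.smul_def,
      map_smul, map_smul, inner_smul_left, inner_smul_left, inner_monomial]
  | add P Q hP hQ => simp only [map_add, inner_add_left, hP, hQ]

theorem not_isCREmbedding {t : ℂ} (ht : t ≠ 0) {N : ℕ} (g : Fin N → Smooth) :
    ¬ IsCREmbedding t g := by
  rintro ⟨hembedding, hCR⟩
  let z : S3 := ⟨EuclideanSpace.single 0 1, by simp⟩
  have neg_z : -z = z := by
    apply hembedding.isEmbedding.injective
    ext j
    exact congrArg (fun f : Smooth => f.1 z) (antipode_eq_self_of_Ltbar_eq_zero ht (hCR j))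
  exact ne_neg_of_mem_unit_sphere ℝ z neg_z.symm

end EigenForms

section KohnLaplacian

theorem h_nonneg (t : ℂ) : 0 ≤ h t := by
  unfold h
  positivity

theorem h_pos {t : ℂ} (ht : ‖t‖ ≠ 1) : 0 < h t := by
  have : 1 - ‖t‖ ^ 2 ≠ 0 := sub_ne_zero.2 fun hsq =>
    ht ((pow_eq_one_iff_of_nonneg (norm_nonneg t) two_ne_zero).1 hsq.symm)
  unfold h
  positivity

theorem re_inner_box (t : ℂ) (u : Smooth) :
    (inner ℂ (toL2 (box t u)) (toL2 u)).re = h t * ‖toL2 (Ltbar t u)‖ ^ 2 := by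
  rw [inner_box_left, inner_box_right, Complex.re_ofReal_mul]
  exact congrArg _ (inner_self_eq_norm_sq (𝕜 := ℂ) _)

theorem eigenvalue_mul_norm_sq {t : ℂ} {r : ℝ} {u : Smooth} (hu : box t u = (r : ℂ) • u) :
    r * ‖toL2 u‖ ^ 2 = h t * ‖toL2 (Ltbar t u)‖ ^ 2 := by
  rw [← re_inner_box, hu, map_smul, inner_smul_left, Complex.conj_ofReal, Complex.re_ofReal_mul]
  exact congrArg _ (inner_self_eq_norm_sq (𝕜 := ℂ) _).symm

theorem norm_toL2_pos {f : Smooth} (hf : f ≠ 0) : 0 < ‖toL2 f‖ :=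
  norm_pos_iff.2 ((map_ne_zero_iff toL2 toL2_injective).2 hf)

theorem eigenvalue_pos_of_antipode_eq_neg {t : ℂ} (ht0 : t ≠ 0) (ht1 : ‖t‖ ≠ 1) {r : ℝ}
    {u : Smooth} (hu0 : u ≠ 0) (hodd : antipode u = -u) (hu : box t u = (r : ℂ) • u) : 0 < r := by
  have not_CR : Ltbar t u ≠ 0 := fun hCR => by
    have : IsAddTorsionFree Smooth := .of_isTorsionFree ℂ _
    exact hu0 (self_eq_neg.1 ((antipode_eq_self_of_Ltbar_eq_zero ht0 hCR).symm.trans hodd))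
  refine pos_of_mul_pos_left (b := ‖toL2 u‖ ^ 2) ?_ (sq_nonneg _)
  rw [eigenvalue_mul_norm_sq hu]
  exact mul_pos (h_pos ht1) (pow_pos (norm_toL2_pos not_CR) 2)

theorem exists_isLeast_eigenvalue_box (t : ℂ) {S : Submodule ℂ Smooth} [FiniteDimensional ℂ S]
    [Nontrivial S] (hS : ∀ u ∈ S, box t u ∈ S) :
    ∃ lam : ℝ, IsLeast {r : ℝ | ∃ u ∈ S, u ≠ 0 ∧ box t u = (r : ℂ) • u} lam ∧
      ∀ u ∈ S, lam * ‖toL2 u‖ ^ 2 ≤ h t * ‖toL2 (Ltbar t u)‖ ^ 2 := by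
  have injective : Function.Injective (toL2 ∘ₗ S.subtype) :=
    toL2_injective.comp S.injective_subtype
  obtain ⟨lam, hleast, hle⟩ := exists_isLeast_hasEigenvalue_of_injective (V := S) injective
    (T := (box t).restrict hS) fun u v => inner_box_left t (u : Smooth) (v : Smooth)
  simp only [hasEigenvalue_restrict_iff hS] at hleast
  refine ⟨lam, hleast, fun u hu => ?_⟩
  rw [← re_inner_box]
  exact hle ⟨u, hu⟩

end KohnLaplacian

section SphericalHarmonics

/-- The Laplacian `∑ ∂²/∂z_i ∂z̄_i` on polynomials, normalized without the factor `4`. -/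
def laplacian : Module.End ℂ Poly :=
  ∑ i : Fin 2, (pderiv (Sum.inl i)).toLinearMap ∘ₗ (pderiv (Sum.inr i)).toLinearMap

theorem laplacian_apply (P : Poly) :
    laplacian P = ∑ i : Fin 2, pderiv (Sum.inl i) (pderiv (Sum.inr i) P) := by
  simp [laplacian]

theorem isHarmonic_iff {P : Poly} : P.IsHarmonic ↔ laplacian P = 0 := by
  rw [Poly.IsHarmonic, ← laplacian_apply, mul_eq_zero, or_iff_right (OfNat.ofNat_ne_zero 4)]

theorem pderiv_inr_Lbarpoly (i : Fin 2) (P : Poly) :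
    pderiv (Sum.inr i) (Lbarpoly P) = Lbarpoly (pderiv (Sum.inr i) P) := by
  simp [Lbarpoly_apply, Derivation.leibniz, pderiv_comm (Sum.inr i)]

theorem pderiv_inl_zero_Lbarpoly (P : Poly) : pderiv (Sum.inl 0) (Lbarpoly P) =
    Lbarpoly (pderiv (Sum.inl 0) P) + pderiv (Sum.inr 1) P := by
  rw [Lbarpoly_apply, Lbarpoly_apply, pderiv_comm (Sum.inr 0), pderiv_comm (Sum.inr 1)]
  simp [Derivation.leibniz, pderiv_X]
  ring

theorem pderiv_inl_one_Lbarpoly (P : Poly) : pderiv (Sum.inl 1) (Lbarpoly P) =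
    Lbarpoly (pderiv (Sum.inl 1) P) - pderiv (Sum.inr 0) P := by
  rw [Lbarpoly_apply, Lbarpoly_apply, pderiv_comm (Sum.inr 0), pderiv_comm (Sum.inr 1)]
  simp [Derivation.leibniz, pderiv_X]
  ring

theorem laplacian_Lbarpoly (P : Poly) : laplacian (Lbarpoly P) = Lbarpoly (laplacian P) := by
  simp only [laplacian_apply, Fin.sum_univ_two, pderiv_inr_Lbarpoly, pderiv_inl_zero_Lbarpoly,
    pderiv_inl_one_Lbarpoly, map_add]
  rw [pderiv_comm (Sum.inr 1) (Sum.inr 0)]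
  ring

/-- The space `𝓗_m(𝕊³)` of spherical harmonics of degree `m`. -/
def sphericalHarmonics (m : ℕ) : Submodule ℂ Smooth :=
  (homogeneousSubmodule (Fin 2 ⊕ Fin 2) ℂ m ⊓ LinearMap.ker laplacian).map res

theorem mem_sphericalHarmonics {m : ℕ} {u : Smooth} :
    u ∈ sphericalHarmonics m ↔ IsSphericalHarmonic m u := by
  constructor
  · rintro ⟨P, hP, rfl⟩
    obtain ⟨hhom, hharm⟩ := Submodule.mem_inf.1 hP
    exact ⟨P, hhom, isHarmonic_iff.2 (LinearMap.mem_ker.1 hharm), res_apply P⟩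
  · rintro ⟨P, hhom, hharm, hPu⟩
    obtain rfl : u = res P := Subtype.ext (funext hPu)
    exact Submodule.mem_map_of_mem
      (Submodule.mem_inf.2 ⟨hhom, LinearMap.mem_ker.2 (isHarmonic_iff.1 hharm)⟩)

theorem Lbar_mem_sphericalHarmonics {m : ℕ} {u : Smooth} (hu : u ∈ sphericalHarmonics m) :
    Lbar u ∈ sphericalHarmonics m := by
  obtain ⟨P, hP, rfl⟩ := hu
  obtain ⟨hhom, hharm⟩ := Submodule.mem_inf.1 hP
  rw [Lbar_res]
  refine Submodule.mem_map_of_mem (Submodule.mem_inf.2 ⟨isHomogeneous_Lbarpoly hhom, ?_⟩)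
  rw [LinearMap.mem_ker, laplacian_Lbarpoly, LinearMap.mem_ker.1 hharm, map_zero]

theorem antipode_of_mem_sphericalHarmonics {m : ℕ} {u : Smooth} (hu : u ∈ sphericalHarmonics m) :
    antipode u = (-1 : ℂ) ^ m • u := by
  obtain ⟨P, hP, rfl⟩ := hu
  exact antipode_res (Submodule.mem_inf.1 hP).1

theorem isHomogeneous_of_isBihomogeneous {P : Poly} {p q : ℕ} (hP : P.IsBihomogeneous p q) :
    P.IsHomogeneous (p + q) := by
  intro d hd
  obtain ⟨hp, hq⟩ := hP d (mem_support_iff.2 hd)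
  rw [← hp, ← hq, ← Fin.sum_univ_two (fun i => d (Sum.inl i)),
    ← Fin.sum_univ_two (fun i => d (Sum.inr i)), ← Fintype.sum_sum_type d,
    ← Finsupp.degree_eq_sum, Finsupp.degree_eq_weight_one]
  rfl

theorem isSphericalHarmonic_of_isBisphericalHarmonic {p q : ℕ} {f : Smooth}
    (hf : IsBisphericalHarmonic p q f) : IsSphericalHarmonic (p + q) f := by
  obtain ⟨P, hbihom, hharm, hPf⟩ := hf
  exact ⟨P, isHomogeneous_of_isBihomogeneous hbihom, hharm, hPf⟩

theorem exists_isBisphericalHarmonic (q : ℕ) : ∃ f : Smooth, f ≠ 0 ∧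
    IsBisphericalHarmonic 0 q f := by
  refine ⟨res (monomial (Finsupp.single (Sum.inr 0) q) 1), fun hzero => ?_, _, ?_, ?_, fun _ => rfl⟩
  · have := congrArg (fun f : Smooth => f.1 ⟨EuclideanSpace.single 0 1, by simp⟩) hzero
    simp [res_apply, Poly.value, eval_monomial] at this
  · intro d hd
    rw [Finset.mem_singleton.1 (support_monomial_subset hd)]
    simp
  · simp [Poly.IsHarmonic]

end SphericalHarmonics

section LadderRelations

/-- The derivation acting on polynomials of bidegree `(p, q)` as multiplication by `p - q`. -/
def weightDeriv : Derivation ℂ Poly Poly :=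
  ∑ i : Fin 2, ((X (Sum.inl i) : Poly) • pderiv (Sum.inl i) -
    (X (Sum.inr i) : Poly) • pderiv (Sum.inr i))

theorem weightDeriv_apply (P : Poly) : weightDeriv P = ∑ i : Fin 2,
    (X (Sum.inl i) * pderiv (Sum.inl i) P - X (Sum.inr i) * pderiv (Sum.inr i) P) := by
  simp [weightDeriv]

theorem weightDeriv_of_isBihomogeneous {P : Poly} {p q : ℕ} (hP : P.IsBihomogeneous p q) :
    weightDeriv P = (p - q : ℂ) • P := by
  conv_lhs => rw [P.as_sum]
  conv_rhs => rw [P.as_sum]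
  rw [map_sum, Finset.smul_sum]
  refine Finset.sum_congr rfl fun d hd => ?_
  obtain ⟨rfl, rfl⟩ := hP d hd
  simp only [weightDeriv_apply, X_mul_pderiv_monomial, Fin.sum_univ_two]
  push_cast
  module

theorem Lpoly_eq_zero_of_isBihomogeneous {P : Poly} {q : ℕ} (hP : P.IsBihomogeneous 0 q) :
    Lpoly P = 0 := by
  have pderiv_inl : ∀ i : Fin 2, pderiv (Sum.inl i) P = 0 := by
    intro i
    refine pderiv_eq_zero_of_notMem_vars fun hi => ?_
    obtain ⟨d, hd, hdi⟩ := (mem_vars_iff_mem_support _).1 hi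
    have hd0 := (hP d hd).1
    have hdi0 := Finsupp.mem_support_iff.1 hdi
    fin_cases i <;> simp only [Fin.zero_eta, Fin.mk_one] at hdi0 <;> omega
  rw [Lpoly_apply, pderiv_inl, pderiv_inl, mul_zero, mul_zero, sub_zero]

theorem commutator_Lpoly_Lbarpoly : ⁅Lpoly, Lbarpoly⁆ = weightDeriv := by
  refine derivation_ext fun k => ?_
  rcases k with k | k <;> fin_cases k <;>
    simp [Derivation.commutator_apply, weightDeriv_apply, Lpoly_apply, Lbarpoly_apply,
      Pi.single_apply]

theorem commutator_weightDeriv_Lbarpoly : ⁅weightDeriv, Lbarpoly⁆ = (2 : ℂ) • Lbarpoly := by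
  refine derivation_ext fun k => ?_
  rcases k with k | k <;> fin_cases k <;>
    simp [Derivation.commutator_apply, weightDeriv_apply, Lbarpoly_apply, Pi.single_apply] <;>
    module

variable {P : Poly} {w : ℂ}

theorem weightDeriv_iterate_Lbarpoly (hw : weightDeriv P = w • P) (j : ℕ) :
    weightDeriv (Lbarpoly^[j] P) = (w + 2 * j) • Lbarpoly^[j] P := by
  induction j with
  | zero => simpa using hw
  | succ j ih =>
    have commutator := DFunLike.congr_fun commutator_weightDeriv_Lbarpoly (Lbarpoly^[j] P)
    rw [Derivation.commutator_apply, ih, sub_eq_iff_eq_add] at commutator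
    rw [Function.iterate_succ_apply', commutator, Derivation.map_smul, Derivation.smul_apply]
    push_cast
    module

theorem Lpoly_iterate_Lbarpoly (hL : Lpoly P = 0) (hw : weightDeriv P = w • P) (j : ℕ) :
    Lpoly (Lbarpoly^[j + 1] P) = ((j + 1) * (w + j)) • Lbarpoly^[j] P := by
  induction j with
  | zero =>
    have commutator := DFunLike.congr_fun commutator_Lpoly_Lbarpoly P
    rw [Derivation.commutator_apply, hL, map_zero, sub_zero, hw] at commutator
    simpa using commutator
  | succ j ih =>
    have commutator := DFunLike.congr_fun commutator_Lpoly_Lbarpoly (Lbarpoly^[j + 1] P)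
    rw [Derivation.commutator_apply, ih, weightDeriv_iterate_Lbarpoly hw,
      sub_eq_iff_eq_add] at commutator
    rw [Function.iterate_succ_apply', commutator, Derivation.map_smul,
      ← Function.iterate_succ_apply' Lbarpoly j]
    push_cast
    module

end LadderRelations

section Primitive

/-- `f` is a lowest weight vector, of weight `-m`, for the `sl₂`-action generated by `𝓛̄` and `𝓛`:
`f` is annihilated by `𝓛`, and `𝓛` descends along the chain `f, 𝓛̄ f, 𝓛̄² f, …`. -/
structure IsPrimitive (m : ℕ) (f : Smooth) : Prop where
  L_eq_zero : L f = 0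
  L_Lbar_pow_succ (j : ℕ) : L ((Lbar ^ (j + 1)) f) = (-((j + 1) * (m - j)) : ℂ) • (Lbar ^ j) f

theorem Lbar_pow_succ (j : ℕ) (f : Smooth) : (Lbar ^ (j + 1)) f = Lbar ((Lbar ^ j) f) := by
  rw [pow_succ', Module.End.mul_apply]

theorem Lbar_pow_res (j : ℕ) (P : Poly) : (Lbar ^ j) (res P) = res (Lbarpoly^[j] P) := by
  induction j with
  | zero => rfl
  | succ j ih => rw [Lbar_pow_succ, ih, Lbar_res, Function.iterate_succ_apply']

theorem isPrimitive_of_isBisphericalHarmonic {m : ℕ} {f : Smooth}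
    (hf : IsBisphericalHarmonic 0 m f) : IsPrimitive m f := by
  obtain ⟨P, hP, -, hPf⟩ := hf
  obtain rfl : f = res P := Subtype.ext (funext hPf)
  have hL := Lpoly_eq_zero_of_isBihomogeneous hP
  refine ⟨by rw [L_res, hL, map_zero], fun j => ?_⟩
  rw [Lbar_pow_res, Lbar_pow_res, L_res,
    Lpoly_iterate_Lbarpoly hL (weightDeriv_of_isBihomogeneous hP), map_smul]
  push_cast
  module

namespace IsPrimitive

variable {m : ℕ} {f : Smooth}

theorem inner_succ (hf : IsPrimitive m f) (i j : ℕ) :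
    inner ℂ (toL2 ((Lbar ^ (i + 1)) f)) (toL2 ((Lbar ^ (j + 1)) f)) =
      ((j + 1) * (m - j) : ℂ) * inner ℂ (toL2 ((Lbar ^ i) f)) (toL2 ((Lbar ^ j) f)) := by
  rw [Lbar_pow_succ i, inner_Lbar, hf.L_Lbar_pow_succ, map_smul, inner_smul_right]
  ring

theorem inner_zero_succ (hf : IsPrimitive m f) (j : ℕ) :
    inner ℂ (toL2 f) (toL2 ((Lbar ^ (j + 1)) f)) = 0 := by
  rw [Lbar_pow_succ, ← neg_eq_zero, ← inner_L, hf.L_eq_zero, map_zero, inner_zero_left]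

theorem inner_eq_zero (hf : IsPrimitive m f) {i j : ℕ} (hij : i < j) :
    inner ℂ (toL2 ((Lbar ^ i) f)) (toL2 ((Lbar ^ j) f)) = 0 := by
  induction i generalizing j with
  | zero =>
    obtain ⟨j, rfl⟩ := Nat.exists_eq_add_of_lt hij
    exact hf.inner_zero_succ _
  | succ i ih =>
    obtain ⟨j, rfl⟩ := Nat.exists_eq_succ_of_ne_zero hij.ne_bot
    rw [hf.inner_succ, ih (Nat.succ_lt_succ_iff.1 hij), mul_zero]

theorem norm_sq_succ (hf : IsPrimitive m f) (j : ℕ) :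
    ‖toL2 ((Lbar ^ (j + 1)) f)‖ ^ 2 = ((j + 1) * (m - j)) * ‖toL2 ((Lbar ^ j) f)‖ ^ 2 := by
  have inner_self := hf.inner_succ j j
  rw [inner_self_eq_norm_sq_to_K, inner_self_eq_norm_sq_to_K] at inner_self
  refine Complex.ofReal_injective ?_
  push_cast
  exact inner_self

theorem norm_sq_Lbar_pow (hf : IsPrimitive m f) (j : ℕ) :
    ‖toL2 ((Lbar ^ j) f)‖ ^ 2 = j.factorial * m.descFactorial j * ‖toL2 f‖ ^ 2 := by
  induction j with
  | zero => simp
  | succ j ih =>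
    have cast_descFactorial : (m.descFactorial (j + 1) : ℝ) = (m - j) * m.descFactorial j := by
      rcases le_or_gt j m with hjm | hjm
      · rw [Nat.descFactorial_succ, Nat.cast_mul, Nat.cast_sub hjm]
      · rw [Nat.descFactorial_succ, Nat.descFactorial_of_lt hjm, mul_zero, Nat.cast_zero, mul_zero]
    rw [hf.norm_sq_succ, ih, cast_descFactorial, Nat.factorial_succ]
    push_cast
    ring

theorem Lbar_pow_eq_zero (hf : IsPrimitive m f) {j : ℕ} (hj : m < j) : (Lbar ^ j) f = 0 := by
  refine (map_eq_zero_iff toL2 toL2_injective).1 (norm_eq_zero.1 (sq_eq_zero_iff.1 ?_))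
  rw [hf.norm_sq_Lbar_pow, Nat.descFactorial_of_lt hj, Nat.cast_zero, mul_zero, zero_mul]

theorem Lbar_pow_ne_zero (hf : IsPrimitive m f) (hf0 : f ≠ 0) {j : ℕ} (hj : j ≤ m) :
    (Lbar ^ j) f ≠ 0 := by
  intro hzero
  have norm_sq := hf.norm_sq_Lbar_pow j
  have hpos := norm_toL2_pos hf0
  have : 0 < m.descFactorial j := Nat.descFactorial_pos.2 hj
  have : (0 : ℝ) < j.factorial * m.descFactorial j * ‖toL2 f‖ ^ 2 := by positivity
  simp [← norm_sq, hzero] at this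

theorem norm_sq_Lbar_pow_self (hf : IsPrimitive m f) :
    ‖toL2 ((Lbar ^ m) f)‖ ^ 2 = (m.factorial : ℝ) ^ 2 * ‖toL2 f‖ ^ 2 := by
  rw [hf.norm_sq_Lbar_pow, Nat.descFactorial_self, sq (m.factorial : ℝ)]

end IsPrimitive

end Primitive

section DoubleFactorial

open scoped Nat

theorem sq_doubleFactorial_odd_le (n : ℕ) : (2 * n + 1)‼ ^ 2 ≤ (2 * n + 1) * (2 * n)‼ ^ 2 := by
  induction n with
  | zero => simp
  | succ n ih =>
    have odd_succ : (2 * (n + 1) + 1)‼ = (2 * n + 3) * (2 * n + 1)‼ :=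
      Nat.doubleFactorial_add_two (2 * n + 1)
    have even_succ : (2 * (n + 1))‼ = (2 * n + 2) * (2 * n)‼ := Nat.doubleFactorial_add_two (2 * n)
    rw [odd_succ, even_succ]
    calc ((2 * n + 3) * (2 * n + 1)‼) ^ 2
        = (2 * n + 3) ^ 2 * (2 * n + 1)‼ ^ 2 := mul_pow _ _ _
      _ ≤ (2 * n + 3) ^ 2 * ((2 * n + 1) * (2 * n)‼ ^ 2) := by gcongr
      _ = (2 * n + 3) * ((2 * n + 3) * (2 * n + 1)) * (2 * n)‼ ^ 2 := by ring
      _ ≤ (2 * n + 3) * (2 * n + 2) ^ 2 * (2 * n)‼ ^ 2 := by gcongr; nlinarith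
      _ = (2 * (n + 1) + 1) * ((2 * n + 2) * (2 * n)‼) ^ 2 := by ring

theorem doubleFactorial_odd_pow_four_le (n : ℕ) :
    (2 * n + 1)‼ ^ 4 ≤ (2 * n + 1) * (2 * n + 1)! ^ 2 :=
  calc (2 * n + 1)‼ ^ 4
      = (2 * n + 1)‼ ^ 2 * (2 * n + 1)‼ ^ 2 := by ring
    _ ≤ (2 * n + 1)‼ ^ 2 * ((2 * n + 1) * (2 * n)‼ ^ 2) := by
      gcongr
      exact sq_doubleFactorial_odd_le n
    _ = (2 * n + 1) * (2 * n + 1)! ^ 2 := by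
      rw [Nat.factorial_eq_mul_doubleFactorial]
      ring

theorem prod_odd_eq_doubleFactorial (n : ℕ) :
    ∏ i ∈ Finset.range (n + 1), (2 * i + 1 : ℂ) = (2 * n + 1)‼ := by
  rw [Finset.prod_range_succ', Nat.doubleFactorial_eq_prod_odd]
  simp

theorem prod_odd_reflect_eq_doubleFactorial (n : ℕ) :
    ∏ i ∈ Finset.range (n + 1), (2 * n + 1 - 2 * i : ℂ) = (2 * n + 1)‼ := by
  rw [← prod_odd_eq_doubleFactorial, ← Finset.prod_range_reflect (fun i : ℕ => (2 * i + 1 : ℂ))]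
  refine Finset.prod_congr rfl fun i hi => ?_
  rw [Nat.add_sub_cancel, Nat.cast_sub (Finset.mem_range_succ_iff.1 hi)]
  ring

end DoubleFactorial

section LowestEigenvalue

variable {n : ℕ} {f : Smooth}

theorem W_le {k : ℕ} {N : Submodule ℂ Smooth} (hN : ∀ u ∈ N, Lbar u ∈ N) (hf : f ∈ N) :
    W k f ≤ N :=
  Submodule.span_le.2 <| Set.range_subset_iff.2 fun _ => Module.End.pow_apply_mem_of_forall_mem _ hN
    f hf

theorem Lbar_pow_odd_mem_W (hf : IsPrimitive (2 * n + 1) f) (j : ℕ) :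
    (Lbar ^ (2 * j + 1)) f ∈ W (n + 1) f := by
  rcases lt_or_ge n j with hj | hj
  · rw [hf.Lbar_pow_eq_zero (by omega)]
    exact zero_mem _
  · exact Submodule.subset_span ⟨⟨j, Nat.lt_succ_of_le hj⟩, rfl⟩

theorem Lt_Lbar_pow_even_mem_W (hf : IsPrimitive (2 * n + 1) f) (t : ℂ) (j : ℕ) :
    Lt t ((Lbar ^ (2 * j)) f) ∈ W (n + 1) f := by
  rw [Lt_apply, ← Lbar_pow_succ]
  refine add_mem ?_ (Submodule.smul_mem _ _ (Lbar_pow_odd_mem_W hf j))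
  rcases j with - | j
  · rw [mul_zero, pow_zero, Module.End.one_apply, hf.L_eq_zero]
    exact zero_mem _
  · rw [Nat.mul_succ, hf.L_Lbar_pow_succ]
    exact Submodule.smul_mem _ _ (Lbar_pow_odd_mem_W hf j)

theorem Ltbar_Lbar_pow_odd (hf : IsPrimitive (2 * n + 1) f) (t : ℂ) (j : ℕ) :
    Ltbar t ((Lbar ^ (2 * j + 1)) f) = (Lbar ^ (2 * (j + 1))) f -
      (t * ((2 * j + 1) * (2 * n + 1 - 2 * j))) • (Lbar ^ (2 * j)) f := by
  rw [Ltbar_apply, hf.L_Lbar_pow_succ, ← Lbar_pow_succ]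
  push_cast
  module

theorem box_mem_W (hf : IsPrimitive (2 * n + 1) f) (t : ℂ) :
    ∀ u ∈ W (n + 1) f, box t u ∈ W (n + 1) f := by
  refine Submodule.span_le (p := (W (n + 1) f).comap (box t)).2 (Set.range_subset_iff.2 fun j => ?_)
  rw [SetLike.mem_coe, Submodule.mem_comap, box_apply, Ltbar_Lbar_pow_odd hf, map_sub, map_smul]
  exact neg_mem (Submodule.smul_mem _ _ (sub_mem (Lt_Lbar_pow_even_mem_W hf t _)
    (Submodule.smul_mem _ _ (Lt_Lbar_pow_even_mem_W hf t _))))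

/-- The coefficient of `𝓛̄^{2j-1} f` in the test function `almostCR t n f`. -/
def almostCRCoeff (t : ℂ) (n j : ℕ) : ℂ :=
  ∏ i ∈ Finset.Ico j (n + 1), t * ((2 * i + 1) * (2 * n + 1 - 2 * i))

theorem almostCRCoeff_of_le (t : ℂ) {j : ℕ} (hj : j ≤ n) : almostCRCoeff t n j =
    t * ((2 * j + 1) * (2 * n + 1 - 2 * j)) * almostCRCoeff t n (j + 1) :=
  Finset.prod_eq_prod_Ico_succ_bot (Nat.lt_succ_of_le hj) _

theorem almostCRCoeff_self (t : ℂ) (n : ℕ) : almostCRCoeff t n (n + 1) = 1 := by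
  rw [almostCRCoeff, Finset.Ico_self, Finset.prod_empty]

theorem almostCRCoeff_zero (t : ℂ) (n : ℕ) :
    almostCRCoeff t n 0 = t ^ (n + 1) * (Nat.doubleFactorial (2 * n + 1) : ℂ) ^ 2 := by
  rw [almostCRCoeff, ← Finset.range_eq_Ico, Finset.prod_mul_distrib, Finset.prod_mul_distrib,
    prod_odd_eq_doubleFactorial, prod_odd_reflect_eq_doubleFactorial, Finset.prod_const,
    Finset.card_range, sq]

/-- The combination of `𝓛̄ f, 𝓛̄³ f, …, 𝓛̄^{2n+1} f`, normalized at the last term, whose image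
under `𝓛̄_t` telescopes to a multiple of `f`. -/
def almostCR (t : ℂ) (n : ℕ) (f : Smooth) : Smooth :=
  ∑ j ∈ Finset.range (n + 1), almostCRCoeff t n (j + 1) • (Lbar ^ (2 * j + 1)) f

theorem almostCR_mem_W (hf : IsPrimitive (2 * n + 1) f) (t : ℂ) : almostCR t n f ∈ W (n + 1) f :=
  sum_mem fun j _ => Submodule.smul_mem _ _ (Lbar_pow_odd_mem_W hf j)

theorem Ltbar_almostCR (hf : IsPrimitive (2 * n + 1) f) (t : ℂ) :
    Ltbar t (almostCR t n f) = -(almostCRCoeff t n 0 • f) := by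
  have telescope : Ltbar t (almostCR t n f) = ∑ j ∈ Finset.range (n + 1),
      (almostCRCoeff t n (j + 1) • (Lbar ^ (2 * (j + 1))) f -
        almostCRCoeff t n j • (Lbar ^ (2 * j)) f) := by
    rw [almostCR, map_sum]
    refine Finset.sum_congr rfl fun j hj => ?_
    rw [map_smul, Ltbar_Lbar_pow_odd hf, almostCRCoeff_of_le t (Finset.mem_range_succ_iff.1 hj)]
    module
  rw [telescope, Finset.sum_range_sub (fun j => almostCRCoeff t n j • (Lbar ^ (2 * j)) f),
    hf.Lbar_pow_eq_zero (by omega), smul_zero, zero_sub, mul_zero, pow_zero, Module.End.one_apply]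

theorem inner_almostCR (hf : IsPrimitive (2 * n + 1) f) (t : ℂ) :
    inner ℂ (toL2 (almostCR t n f)) (toL2 ((Lbar ^ (2 * n + 1)) f)) =
      (‖toL2 ((Lbar ^ (2 * n + 1)) f)‖ : ℂ) ^ 2 := by
  rw [almostCR, Finset.sum_range_succ, almostCRCoeff_self, one_smul, map_add, inner_add_left,
    inner_self_eq_norm_sq_to_K, map_sum, sum_inner, Finset.sum_eq_zero, zero_add]
  · rfl
  · intro j hj
    have hjn := Finset.mem_range.1 hj
    rw [map_smul, inner_smul_left, hf.inner_eq_zero (by omega), mul_zero]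

theorem norm_Lbar_pow_le_norm_almostCR (hf : IsPrimitive (2 * n + 1) f) (t : ℂ) :
    ‖toL2 ((Lbar ^ (2 * n + 1)) f)‖ ≤ ‖toL2 (almostCR t n f)‖ := by
  rcases (norm_nonneg (toL2 ((Lbar ^ (2 * n + 1)) f))).eq_or_lt with hzero | hpos
  · exact hzero.symm.trans_le (norm_nonneg _)
  · refine le_of_mul_le_mul_right ?_ hpos
    have cauchy_schwarz := norm_inner_le_norm (𝕜 := ℂ) (toL2 (almostCR t n f))
      (toL2 ((Lbar ^ (2 * n + 1)) f))
    rwa [inner_almostCR hf, norm_pow, Complex.norm_real, norm_norm, sq] at cauchy_schwarz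

theorem norm_sq_Ltbar_almostCR_le (hf : IsPrimitive (2 * n + 1) f) (t : ℂ) :
    ‖toL2 (Ltbar t (almostCR t n f))‖ ^ 2 ≤
      (2 * n + 1) * ‖t‖ ^ (2 * (n + 1)) * ‖toL2 (almostCR t n f)‖ ^ 2 := by
  have factorial_bound : (Nat.doubleFactorial (2 * n + 1) : ℝ) ^ 4 ≤
      (2 * n + 1) * ((2 * n + 1).factorial : ℝ) ^ 2 := by
    exact_mod_cast doubleFactorial_odd_pow_four_le n
  calc ‖toL2 (Ltbar t (almostCR t n f))‖ ^ 2
      = ‖t‖ ^ (2 * (n + 1)) * (Nat.doubleFactorial (2 * n + 1) : ℝ) ^ 4 * ‖toL2 f‖ ^ 2 := by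
        rw [Ltbar_almostCR hf, almostCRCoeff_zero, map_neg, map_smul, norm_neg, norm_smul, norm_mul,
          norm_pow, norm_pow, Complex.norm_natCast]
        ring
    _ ≤ ‖t‖ ^ (2 * (n + 1)) * ((2 * n + 1) * ((2 * n + 1).factorial : ℝ) ^ 2) *
          ‖toL2 f‖ ^ 2 := by gcongr
    _ = (2 * n + 1) * ‖t‖ ^ (2 * (n + 1)) * ‖toL2 ((Lbar ^ (2 * n + 1)) f)‖ ^ 2 := by
        rw [hf.norm_sq_Lbar_pow_self]
        ring
    _ ≤ (2 * n + 1) * ‖t‖ ^ (2 * (n + 1)) * ‖toL2 (almostCR t n f)‖ ^ 2 := by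
        gcongr
        exact norm_Lbar_pow_le_norm_almostCR hf t

theorem isSphericalHarmonic_of_mem_W {k m : ℕ} (hf : IsBisphericalHarmonic 0 m f) {u : Smooth}
    (hu : u ∈ W k f) : IsSphericalHarmonic m u := by
  have hf' := isSphericalHarmonic_of_isBisphericalHarmonic hf
  rw [zero_add] at hf'
  exact mem_sphericalHarmonics.1
    (W_le (fun _ => Lbar_mem_sphericalHarmonics) (mem_sphericalHarmonics.2 hf') hu)

theorem antipode_of_mem_W {k : ℕ} (hf : IsBisphericalHarmonic 0 (2 * n + 1) f) {u : Smooth}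
    (hu : u ∈ W k f) : antipode u = -u := by
  rw [antipode_of_mem_sphericalHarmonics
      (mem_sphericalHarmonics.2 (isSphericalHarmonic_of_mem_W hf hu)),
    (odd_two_mul_add_one n).neg_one_pow]
  exact neg_one_smul ℂ u

theorem exists_isLeast_eigenvalue_W {t : ℂ} (ht0 : t ≠ 0) (ht1 : ‖t‖ ≠ 1) (hf0 : f ≠ 0)
    (hf : IsBisphericalHarmonic 0 (2 * n + 1) f) :
    ∃ lam : ℝ, IsLeast {r : ℝ | ∃ u ∈ W (n + 1) f, u ≠ 0 ∧ box t u = (r : ℂ) • u} lam ∧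
      0 < lam ∧ lam ≤ h t * (2 * n + 1) * ‖t‖ ^ (2 * (n + 1)) := by
  have primitive := isPrimitive_of_isBisphericalHarmonic hf
  have : FiniteDimensional ℂ (W (n + 1) f) :=
    FiniteDimensional.span_of_finite ℂ (Set.finite_range _)
  have Lbar_ne_zero := primitive.Lbar_pow_ne_zero hf0 (Nat.le_add_left 1 (2 * n))
  have : Nontrivial (W (n + 1) f) := (Submodule.nontrivial_iff_ne_bot).2
    ((Submodule.ne_bot_iff _).2 ⟨_, Lbar_pow_odd_mem_W primitive 0, Lbar_ne_zero⟩)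
  obtain ⟨lam, hleast, hle⟩ := exists_isLeast_eigenvalue_box t (box_mem_W primitive t)
  refine ⟨lam, hleast, ?_, ?_⟩
  · obtain ⟨u, huW, hu0, hu⟩ := hleast.1
    exact eigenvalue_pos_of_antipode_eq_neg ht0 ht1 hu0 (antipode_of_mem_W hf huW) hu
  · have norm_pos : 0 < ‖toL2 (almostCR t n f)‖ :=
      (norm_toL2_pos (primitive.Lbar_pow_ne_zero hf0 le_rfl)).trans_le
        (norm_Lbar_pow_le_norm_almostCR primitive t)
    refine le_of_mul_le_mul_right ?_ (pow_pos norm_pos 2)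
    calc lam * ‖toL2 (almostCR t n f)‖ ^ 2
        ≤ h t * ‖toL2 (Ltbar t (almostCR t n f))‖ ^ 2 := hle _ (almostCR_mem_W primitive t)
      _ ≤ h t * ((2 * n + 1) * ‖t‖ ^ (2 * (n + 1)) * ‖toL2 (almostCR t n f)‖ ^ 2) :=
        mul_le_mul_of_nonneg_left (norm_sq_Ltbar_almostCR_le primitive t) (h_nonneg t)
      _ = h t * (2 * n + 1) * ‖t‖ ^ (2 * (n + 1)) * ‖toL2 (almostCR t n f)‖ ^ 2 := by ring

end LowestEigenvalue

section Spectrum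

theorem zero_mem_spec (t : ℂ) : (0 : ℂ) ∈ spec (boxL2 t) := by
  refine mem_spec_boxL2 (f := res 1) (fun hzero => ?_) ?_
  · have := congrArg (fun f : Smooth => f.1 ⟨EuclideanSpace.single 0 1, by simp⟩) hzero
    simp [res_apply, Poly.value] at this
  · rw [box_apply, Ltbar_apply, L_res, Lbar_res]
    simp

theorem tendsto_eigenvalue_bound {t : ℂ} (ht : ‖t‖ < 1) :
    Filter.Tendsto (fun n : ℕ => h t * (2 * n + 1) * ‖t‖ ^ (2 * (n + 1))) Filter.atTop (𝓝 0) := by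
  have sq_lt_one : ‖t‖ ^ 2 < 1 := pow_lt_one₀ (norm_nonneg t) ht two_ne_zero
  have linear := tendsto_self_mul_const_pow_of_lt_one (sq_nonneg ‖t‖) sq_lt_one
  have geometric := tendsto_pow_atTop_nhds_zero_of_lt_one (sq_nonneg ‖t‖) sq_lt_one
  have combined := ((linear.const_mul 2).add geometric).const_mul (h t * ‖t‖ ^ 2)
  simp only [mul_zero, add_zero] at combined
  refine combined.congr fun n => ?_
  rw [pow_mul]
  ring

theorem accPt_zero_spec {t : ℂ} (ht0 : t ≠ 0) (ht1 : ‖t‖ < 1) :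
    AccPt (0 : ℂ) (Filter.principal (spec (boxL2 t))) := by
  have small_eigenvalue : ∀ n : ℕ, ∃ lam : ℝ, (lam : ℂ) ∈ spec (boxL2 t) ∧ 0 < lam ∧
      lam ≤ h t * (2 * n + 1) * ‖t‖ ^ (2 * (n + 1)) := by
    intro n
    obtain ⟨f, hf0, hf⟩ := exists_isBisphericalHarmonic (2 * n + 1)
    obtain ⟨lam, ⟨⟨u, -, hu0, hu⟩, -⟩, bounds⟩ := exists_isLeast_eigenvalue_W ht0 ht1.ne hf0 hf
    exact ⟨lam, mem_spec_boxL2 hu0 hu, bounds⟩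
  choose lam hspec hpos hle using small_eigenvalue
  have tendsto_zero : Filter.Tendsto (fun n => (lam n : ℂ)) Filter.atTop (𝓝 0) :=
    (Complex.continuous_ofReal.tendsto' 0 0 Complex.ofReal_zero).comp
      (squeeze_zero (fun n => (hpos n).le) hle (tendsto_eigenvalue_bound ht1))
  rw [accPt_iff_frequently]
  exact tendsto_zero.frequently (Filter.Frequently.of_forall fun n =>
    ⟨Complex.ofReal_ne_zero.2 (hpos n).ne', hspec n⟩)

end Spectrum

end Rossi

end

theorem mainTheorem1 (t : ℂ) (ht0 : 0 < ‖t‖) (ht1 : ‖t‖ < 1) :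
    IsSelfAdjoint (Rossi.boxL2 t) ∧
    (0 : ℂ) ∈ Rossi.essSpec (Rossi.boxL2 t) ∧
    AccPt (0 : ℂ) (Filter.principal (Rossi.spec (Rossi.boxL2 t))) ∧
    (∀ k : ℕ, 1 ≤ k → ∀ f : Rossi.Smooth, f ≠ 0 → Rossi.IsBisphericalHarmonic 0 (2 * k - 1) f →
      (∀ u ∈ Rossi.W k f, Rossi.IsSphericalHarmonic (2 * k - 1) u) ∧
      (∀ u ∈ Rossi.W k f, Rossi.box t u ∈ Rossi.W k f) ∧
      ∃ lam : ℝ,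
        IsLeast {r : ℝ | ∃ u ∈ Rossi.W k f, u ≠ 0 ∧ Rossi.box t u = (r : ℂ) • u} lam ∧
        0 < lam ∧
        lam ≤ Rossi.h t * (2 * (k : ℝ) - 1) * Real.sqrt (k : ℝ) * ‖t‖ ^ (2 * k)) ∧
    (∀ N : ℕ, ¬ ∃ g : Fin N → Rossi.Smooth, Rossi.IsCREmbedding t g) := by
  have ht : t ≠ 0 := norm_pos_iff.1 ht0
  have accPt := Rossi.accPt_zero_spec ht ht1
  refine ⟨Rossi.isSelfAdjoint_boxL2 t, ⟨Rossi.zero_mem_spec t, Or.inl accPt⟩, accPt, ?_,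
    fun N ⟨g, hg⟩ => Rossi.not_isCREmbedding ht g hg⟩
  intro k hk f hf0 hf
  obtain ⟨n, rfl⟩ := Nat.exists_eq_add_of_le' hk
  refine ⟨fun u hu => Rossi.isSphericalHarmonic_of_mem_W hf hu,
    Rossi.box_mem_W (Rossi.isPrimitive_of_isBisphericalHarmonic hf) t, ?_⟩
  obtain ⟨lam, hleast, hpos, hle⟩ := Rossi.exists_isLeast_eigenvalue_W ht ht1.ne hf0 hf
  refine ⟨lam, hleast, hpos, ?_⟩
  calc lam ≤ Rossi.h t * (2 * n + 1) * ‖t‖ ^ (2 * (n + 1)) := hle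
    _ ≤ Rossi.h t * (2 * n + 1) * √(n + 1 : ℕ) * ‖t‖ ^ (2 * (n + 1)) :=
      mul_le_mul_of_nonneg_right (le_mul_of_one_le_right
        (mul_nonneg (Rossi.h_nonneg t) (by positivity)) (Real.one_le_sqrt.2 (mod_cast hk)))
        (by positivity)
    _ = _ := by push_cast; ring
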